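/- Let $N>1$ be an integer, $p\ge 2$, $s\in(0,1)$ with $ps<N$, and let $\Omega\subset\mathbb{R}^N$ be a bounded domain with $C^{1,1}$ boundary; write $\Omega^c=\mathbb{R}^N\setminus\Omega$ and $p_s^*=\frac{Np}{N-ps}$. Inequalities and equalities between functions are meant almost everywhere. For an open set $U\subseteq\mathbb{R}^N$ let $W^{s,p}(U)$ be the set of all $u\in L^p(U)$ with $\iint_{U\times U}\frac{|u(x)-u(y)|^p}{|x-y|^{N+ps}}\,dx\,dy<\infty$, and let $W^{s,p}_0(\Omega)=\{u\in W^{s,p}(\mathbb{R}^N): u=0 \text{ in } \Omega^c\}$. Let $\widetilde W^{s,p}(\Omega)$ be the set of all $u\in L^p_{\rm loc}(\mathbb{R}^N)$ such that $u\in W^{s,p}(U)$ for some open $U\supset\overline\Omega$ and $\int_{\mathbb{R}^N}\frac{|u(x)|^{p-1}}{(1+|x|)^{N+ps}}\,dx<\infty$. For $u\in\widetilde W^{s,p}(\Omega)$ and $v\in W^{s,p}_0(\Omega)$ set $$\langle(-\Delta)_p^s u,v\rangle=\iint_{\mathbb{R}^N\times\mathbb{R}^N}\frac{|u(x)-u(y)|^{p-2}(u(x)-u(y))(v(x)-v(y))}{|x-y|^{N+ps}}\,dx\,dy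 .$$ Let $f:\Omega\times\mathbb{R}\to\mathbb{R}$ satisfy hypothesis $\mathbf{H}_0$: $f$ is a Carathéodory function, and there are $c_0>0$ and $q\in(p,p_s^*)$ such that $|f(x,t)|\le c_0(1+|t|^{q-1})$ for a.e. $x\in\Omega$ and all $t\in\mathbb{R}$. Consider the problem $$(-\Delta)_p^s u=f(x,u)\ \text{ in }\Omega,\qquad u=0\ \text{ in }\Omega^c. \tag{P}$$ A function $u\in\widetilde W^{s,p}(\Omega)$ is a supersolution (respectively, subsolution) of (P) if $u\ge 0$ (respectively, $u\le 0$) in $\Omega^c$ and $\langle(-\Delta)_p^s u,v\rangle\ge\int_\Omega f(x,u)v\,dx$ (respectively, $\le$) for all $v\in W^{s,p}_0(\Omega)$ with $v\ge 0$. A function $u\in W^{s,p}_0(\Omega)$ is a solution of (P) if $\langle(-\Delta)_p^s u,v\rangle=\int_\Omega f(x,u)v\,dx$ for all $v\in W^{s,p}_0(\Omega)$. Let $\underline u,\overline u\in\widetilde W^{s,p}(\Omega)$ be a subsolution and a supersolution of (P), respectively, with $\underline u\le\overline u$ in $\Omega$. Then there exists a solution $u\in W^{s,p}_0(\Omega)$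 of (P) with $\underline u\le u\le\overline u$ a.e. in $\mathbb{R}^N$ (in particular in $\Omega$). -/

import Mathlib

open MeasureTheory Set
open scoped ENNReal NNReal

noncomputable section

namespace FracPLap

/-- The space `ℝ^N` with its Euclidean norm. -/
abbrev Sp (N : ℕ) : Type := EuclideanSpace ℝ (Fin N)

/-- The boundary of `Ω` is locally, after a rotation, the graph of a function of class `C^{1,1}`
(continuously differentiable with Lipschitz gradient), with `Ω` lying on one side of the graph:
`ν` is the vertical direction, and `x - ⟪ν, x⟫ ν` is the horizontal component of `x`. -/
def HasC11Boundary {N : ℕ} (Ω : Set (Sp N)) : Prop :=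
  ∀ x₀ ∈ frontier Ω, ∃ (r : ℝ) (ν : Sp N) (g : Sp N → ℝ) (K : ℝ≥0),
    0 < r ∧ ‖ν‖ = 1 ∧ ContDiff ℝ 1 g ∧ LipschitzWith K (fderiv ℝ g) ∧
    ∀ x ∈ Metric.ball x₀ r,
      (x ∈ Ω ↔ g (x - (inner ℝ ν x : ℝ) • ν) < inner ℝ ν x)

/-- A bounded domain (nonempty connected open set) with `C^{1,1}` boundary. -/
structure IsC11Domain {N : ℕ} (Ω : Set (Sp N)) : Prop where
  isOpen : IsOpen Ω
  isConnected : IsConnected Ω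
  isBounded : Bornology.IsBounded Ω
  boundary : HasC11Boundary Ω

variable {N : ℕ}

/-- The `p`-th power of the Gagliardo seminorm of `u` on `U`:
`∬_{U × U} |u(x) - u(y)|^p / |x - y|^{N + ps} dx dy`. -/
def gagliardo (s p : ℝ) (U : Set (Sp N)) (u : Sp N → ℝ) : ℝ≥0∞ :=
  ∫⁻ z : Sp N × Sp N in U ×ˢ U,
    ENNReal.ofReal (|u z.1 - u z.2| ^ p / ‖z.1 - z.2‖ ^ ((N : ℝ) + p * s))

/-- `u ∈ W^{s,p}(U)`: `u ∈ L^p(U)` with finite Gagliardo seminorm on `U`. -/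
def MemW (s p : ℝ) (U : Set (Sp N)) (u : Sp N → ℝ) : Prop :=
  MemLp u (ENNReal.ofReal p) (volume.restrict U) ∧ gagliardo s p U u < ∞

/-- `u ∈ W₀^{s,p}(Ω)`: `u ∈ W^{s,p}(ℝ^N)` and `u = 0` a.e. in the complement of `Ω`. -/
def MemW₀ (s p : ℝ) (Ω : Set (Sp N)) (u : Sp N → ℝ) : Prop :=
  MemW s p univ u ∧ ∀ᵐ x, x ∉ Ω → u x = 0

/-- `u ∈ W̃^{s,p}(Ω)`: `u ∈ L^p_loc(ℝ^N)`, `u ∈ W^{s,p}(U)` for some open `U` containing the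
closure of `Ω`, and `∫ |u(x)|^{p-1} / (1 + |x|)^{N + ps} dx < ∞`. -/
def MemWt (s p : ℝ) (Ω : Set (Sp N)) (u : Sp N → ℝ) : Prop :=
  (∀ K : Set (Sp N), IsCompact K → MemLp u (ENNReal.ofReal p) (volume.restrict K)) ∧
  (∃ U : Set (Sp N), IsOpen U ∧ closure Ω ⊆ U ∧ MemW s p U u) ∧
  ∫⁻ x, ENNReal.ofReal (|u x| ^ (p - 1) / (1 + ‖x‖) ^ ((N : ℝ) + p * s)) < ∞

/-- The duality pairing `⟨(-Δ)_p^s u, v⟩`, that is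
`∬_{ℝ^N × ℝ^N} |u(x) - u(y)|^{p-2} (u(x) - u(y)) (v(x) - v(y)) / |x - y|^{N + ps} dx dy`.
For `u ∈ W̃^{s,p}(Ω)` and `v ∈ W₀^{s,p}(Ω)` the integrand is absolutely integrable. -/
def pairing (s p : ℝ) (u v : Sp N → ℝ) : ℝ :=
  ∫ z : Sp N × Sp N,
    |u z.1 - u z.2| ^ (p - 2) * (u z.1 - u z.2) * (v z.1 - v z.2)
      / ‖z.1 - z.2‖ ^ ((N : ℝ) + p * s)

/-- `f : Ω × ℝ → ℝ` is a Carathéodory function: `f(·, t)` is (Lebesgue) measurable on `Ω` for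
every `t`, and `f(x, ·)` is continuous for a.e. `x ∈ Ω`. -/
def IsCaratheodory (Ω : Set (Sp N)) (f : Sp N → ℝ → ℝ) : Prop :=
  (∀ t : ℝ, AEMeasurable (fun x => f x t) (volume.restrict Ω)) ∧
  ∀ᵐ x ∂(volume.restrict Ω), Continuous (f x)

/-- The standing hypothesis on the reaction: `f` is a Carathéodory function of subcritical growth,
`|f(x,t)| ≤ c₀ (1 + |t|^{q-1})` for a.e. `x ∈ Ω` and all `t`, for some `c₀ > 0` and some
exponent `q` strictly between `p` and `p_s^* = Np / (N - ps)`. -/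
def H₀ (s p : ℝ) (Ω : Set (Sp N)) (f : Sp N → ℝ → ℝ) : Prop :=
  IsCaratheodory Ω f ∧
  ∃ c₀ q : ℝ, 0 < c₀ ∧ p < q ∧ q < (N : ℝ) * p / ((N : ℝ) - p * s) ∧
    ∀ᵐ x ∂(volume.restrict Ω), ∀ t : ℝ, |f x t| ≤ c₀ * (1 + |t| ^ (q - 1))

/-- `u` is a supersolution of `(-Δ)_p^s u = f(x,u)` in `Ω`, `u = 0` in the complement of `Ω`. -/
def IsSupersolution (s p : ℝ) (Ω : Set (Sp N)) (f : Sp N → ℝ → ℝ) (u : Sp N → ℝ) : Prop :=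
  MemWt s p Ω u ∧ (∀ᵐ x, x ∉ Ω → 0 ≤ u x) ∧
  ∀ v : Sp N → ℝ, MemW₀ s p Ω v → (∀ᵐ x, 0 ≤ v x) →
    ∫ x in Ω, f x (u x) * v x ≤ pairing s p u v

/-- `u` is a subsolution of the same problem. -/
def IsSubsolution (s p : ℝ) (Ω : Set (Sp N)) (f : Sp N → ℝ → ℝ) (u : Sp N → ℝ) : Prop :=
  MemWt s p Ω u ∧ (∀ᵐ x, x ∉ Ω → u x ≤ 0) ∧
  ∀ v : Sp N → ℝ, MemW₀ s p Ω v → (∀ᵐ x, 0 ≤ v x) →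
    pairing s p u v ≤ ∫ x in Ω, f x (u x) * v x

/-- `(u₁, u₂)` is a sub-supersolution pair: `u₁` is a subsolution, `u₂` is a supersolution, and
`u₁ ≤ u₂` a.e. in `Ω`. -/
def IsSubSuperPair (s p : ℝ) (Ω : Set (Sp N)) (f : Sp N → ℝ → ℝ) (u₁ u₂ : Sp N → ℝ) : Prop :=
  IsSubsolution s p Ω f u₁ ∧ IsSupersolution s p Ω f u₂ ∧
  ∀ᵐ x, x ∈ Ω → u₁ x ≤ u₂ x

/-- `u` is a (weak) solution of the problem. -/
def IsSolution (s p : ℝ) (Ω : Set (Sp N)) (f : Sp N → ℝ → ℝ) (u : Sp N → ℝ) : Prop :=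
  MemW₀ s p Ω u ∧
  ∀ v : Sp N → ℝ, MemW₀ s p Ω v → pairing s p u v = ∫ x in Ω, f x (u x) * v x

/-- The set `𝒮(u₁, u₂)` of the solutions `u` with `u₁ ≤ u ≤ u₂` a.e. (in all of `ℝ^N`). -/
def solutionSet (s p : ℝ) (Ω : Set (Sp N)) (f : Sp N → ℝ → ℝ) (u₁ u₂ : Sp N → ℝ) :
    Set (Sp N → ℝ) :=
  {u | IsSolution s p Ω f u ∧ ∀ᵐ x, u₁ x ≤ u x ∧ u x ≤ u₂ x}

end FracPLap

end

/-!
The solution is found by the direct method, in a form that needs neither compactness nor functional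
analysis.

Clamp the reaction to the order interval `[u₁, u₂]` and let `Φ(w) = [w]^p / p - ∫_Ω F(x, w)`, with
`F` the primitive of the clamped reaction, be the energy of the resulting problem. On the set of
`w ∈ W₀^{s,p}(Ω)` with `u₁ ≤ w ≤ u₂` this functional is bounded below, its sublevel sets are closed
under pointwise limits (Fatou's lemma and dominated convergence), and it is submodular,
`Φ(v ⊔ w) + Φ(v ⊓ w) ≤ Φ(v) + Φ(w)`, because `|·|^p` is convex. Submodularity replaces the compact
embedding: suprema of almost-minimizers are almost-minimizers, so the upper limit of a fast
minimizing sequence is a minimizer (`exists_forall_le_of_submodular`).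

The minimizer in the order interval minimizes `Φ` over all of `W₀^{s,p}(Ω)`, since cutting a
competitor at `u₂` or raising it to `u₁` does not increase `Φ`
(`Barriers.functional_inf_le`, `Barriers.functional_sup_le`). For the upper barrier, with
`ψ = (w - u₂)⁺`, convexity of the energy and monotonicity of `a ↦ |a|^{p-2} a` give
`([w]^p - [w ⊓ u₂]^p) / p ≥ ⟨A (w ⊓ u₂), ψ⟩ ≥ ⟨A u₂, ψ⟩ ≥ ∫_Ω f(x, u₂) ψ`, and the last integral is
exactly the change of the reaction term. The Euler-Lagrange equation of an unconstrained minimizer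
that lies in `[u₁, u₂]` is the equation to be solved.

The analytic input consists of the absolute convergence of the pairing
(`TailSob.integrable_pairing`) and of the subcritical Sobolev embedding
(`integrable_abs_rpow_of_lt_critical`), which makes the reaction term meaningful. The latter comes
from the level sets of `w`: the mass of the kernel outside a set of measure `a` is at least a
multiple of `a^{-ps/N}`, so `|{|w| > 2t}| ≤ C t^{-p} |{|w| > t}|^{ps/N}`, and iteration over dyadic
`t` gives the decay `t^{-Np/(N-ps)}`. For the barriers, which are in `W^{s,p}` only near the closure
of `Ω`, a cutoff comes first.
-/

namespace FracPLap

open Filter Topology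

/-! ### Inequalities for powers -/

/-- The odd power `a ↦ |a|^{p-2} a`, the derivative of `|a|^p / p`. -/
noncomputable def oddPow (p a : ℝ) : ℝ := |a| ^ (p - 2) * a

lemma oddPow_of_nonneg {p a : ℝ} (hp : 2 ≤ p) (ha : 0 ≤ a) : oddPow p a = a ^ (p - 1) := by
  rcases ha.eq_or_lt with rfl | h
  · simp [oddPow, Real.zero_rpow (by linarith : p - 1 ≠ 0)]
  · rw [oddPow, abs_of_pos h, ← Real.rpow_add_one h.ne']; congr 1; ring

lemma oddPow_neg (p a : ℝ) : oddPow p (-a) = -oddPow p a := by simp [oddPow]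

lemma abs_oddPow {p : ℝ} (hp : 2 ≤ p) (a : ℝ) : |oddPow p a| = |a| ^ (p - 1) := by
  rw [← oddPow_of_nonneg hp (abs_nonneg a), oddPow, oddPow, abs_mul, abs_abs,
    abs_of_nonneg (Real.rpow_nonneg (abs_nonneg a) _)]

lemma continuous_oddPow {p : ℝ} (hp : 2 ≤ p) : Continuous (oddPow p) :=
  (continuous_abs.rpow_const fun _ => Or.inr (by linarith)).mul continuous_id

lemma monotone_oddPow {p : ℝ} (hp : 2 ≤ p) : Monotone (oddPow p) := by
  have key : ∀ a b : ℝ, 0 ≤ a → a ≤ b → oddPow p a ≤ oddPow p b := fun a b ha hab => by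
    rw [oddPow_of_nonneg hp ha, oddPow_of_nonneg hp (ha.trans hab)]
    exact Real.rpow_le_rpow ha hab (by linarith)
  have hz : oddPow p 0 = 0 := by simp [oddPow]
  intro a b hab
  rcases le_total 0 a with ha | ha
  · exact key a b ha hab
  rcases le_total 0 b with hb | hb
  · have h1 := key 0 (-a) le_rfl (by linarith)
    have h2 := key 0 b le_rfl hb
    rw [oddPow_neg] at h1
    linarith
  · have := key (-b) (-a) (by linarith) (by linarith)
    rw [oddPow_neg, oddPow_neg] at this
    linarith

lemma abs_rpow_eq_oddPow_mul {p : ℝ} (hp : 2 ≤ p) (a : ℝ) : |a| ^ p = oddPow p a * a := by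
  rcases eq_or_ne a 0 with rfl | h
  · simp [Real.zero_rpow (by linarith : p ≠ 0)]
  · have h2 : |a| ^ p = |a| ^ (p - 2) * |a| ^ (2 : ℝ) := by
      rw [← Real.rpow_add (abs_pos.2 h)]; congr 1; ring
    rw [h2, oddPow]
    norm_cast
    rw [sq_abs]; ring

lemma convexOn_abs_rpow {p : ℝ} (hp : 1 ≤ p) : ConvexOn ℝ univ fun a : ℝ => |a| ^ p := by
  refine ⟨convex_univ, fun a _ b _ x y hx hy hxy => ?_⟩
  calc |x • a + y • b| ^ p ≤ (x * |a| + y * |b|) ^ p := by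
        refine Real.rpow_le_rpow (abs_nonneg _) ?_ (by linarith)
        refine (abs_add_le _ _).trans_eq ?_
        simp [abs_mul, abs_of_nonneg hx, abs_of_nonneg hy]
    _ ≤ x • |a| ^ p + y • |b| ^ p :=
        (convexOn_rpow hp).2 (abs_nonneg a) (abs_nonneg b) hx hy hxy

/-- Young's inequality without the optimal constants. -/
lemma rpow_sub_one_mul_le {p a b : ℝ} (hp : 1 ≤ p) (ha : 0 ≤ a) (hb : 0 ≤ b) :
    a ^ (p - 1) * b ≤ a ^ p + b ^ p := by
  have key : ∀ c : ℝ, 0 ≤ c → c ^ (p - 1) * c = c ^ p := fun c hc => by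
    rcases hc.eq_or_lt with rfl | h
    · simp [Real.zero_rpow (by linarith : p ≠ 0)]
    · rw [← Real.rpow_add_one h.ne']; congr 1; ring
  rcases le_total a b with h | h
  · have : a ^ (p - 1) * b ≤ b ^ (p - 1) * b :=
      mul_le_mul_of_nonneg_right (Real.rpow_le_rpow ha h (by linarith)) hb
    rw [key b hb] at this
    linarith [Real.rpow_nonneg ha p]
  · have : a ^ (p - 1) * b ≤ a ^ (p - 1) * a :=
      mul_le_mul_of_nonneg_left h (Real.rpow_nonneg ha _)
    rw [key a ha] at this
    linarith [Real.rpow_nonneg hb p]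

/-- The tangent line of `|·|^p` at `a` lies below the graph. -/
lemma abs_rpow_add_oddPow_mul_sub_le {p : ℝ} (hp : 2 ≤ p) (a b : ℝ) :
    |a| ^ p + p * (oddPow p a * (b - a)) ≤ |b| ^ p := by
  have h1 : p * (oddPow p a * b) ≤ (p - 1) * |a| ^ p + |b| ^ p := by
    have hpq : (p / (p - 1)).HolderConjugate p := (Real.HolderConjugate.conjExponent
      (by linarith : 1 < p)).symm
    have hy := Real.young_inequality_of_nonneg (a := |a| ^ (p - 1)) (b := |b|)
      (by positivity) (abs_nonneg b) hpq
    have hp1 : p - 1 ≠ 0 := by linarith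
    rw [← Real.rpow_mul (abs_nonneg a), mul_div_cancel₀ _ hp1] at hy
    have h2 : oddPow p a * b ≤ |a| ^ (p - 1) * |b| := by
      rw [← abs_oddPow hp, ← abs_mul]; exact le_abs_self _
    have h3 : p * (|a| ^ p / (p / (p - 1)) + |b| ^ p / p) = (p - 1) * |a| ^ p + |b| ^ p := by
      field_simp
    rw [← h3]
    exact mul_le_mul_of_nonneg_left (h2.trans hy) (by linarith)
  have := abs_rpow_eq_oddPow_mul hp a
  nlinarith

lemma abs_add_rpow_le {r : ℝ} (hr : 0 ≤ r) (a b : ℝ) :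
    |a + b| ^ r ≤ 2 ^ r * (|a| ^ r + |b| ^ r) := by
  have h : |a + b| ≤ 2 * max |a| |b| := by
    linarith [abs_add_le a b, le_max_left |a| |b|, le_max_right |a| |b|]
  refine (Real.rpow_le_rpow (abs_nonneg _) h hr).trans ?_
  rw [Real.mul_rpow (by norm_num) (by positivity)]
  refine mul_le_mul_of_nonneg_left ?_ (by positivity)
  have h1 : 0 ≤ |a| ^ r := by positivity
  have h2 : 0 ≤ |b| ^ r := by positivity
  rcases max_choice |a| |b| with h | h <;> rw [h] <;> linarith

/-- Two numbers with a given sum have the smaller `|·|^p`-sum when they are closer together. -/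
lemma abs_rpow_add_le_of_between {p : ℝ} (hp : 1 ≤ p) {α β s t : ℝ} (h1 : β ≤ s) (h2 : s ≤ α)
    (hst : s + t = α + β) : |s| ^ p + |t| ^ p ≤ |α| ^ p + |β| ^ p := by
  rcases (h1.trans h2).eq_or_lt with h | h
  · have hs : s = α := by linarith
    have ht : t = β := by linarith
    rw [hs, ht]
  have hd : 0 < α - β := by linarith
  have hd' := hd.ne'
  have hc := (convexOn_abs_rpow hp).2
  set l := (s - β) / (α - β) with hl
  have hl0 : 0 ≤ l := div_nonneg (by linarith) hd.le
  have hl1 : 0 ≤ 1 - l := by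
    rw [hl, sub_nonneg, div_le_one hd]; linarith
  have hs : l • α + (1 - l) • β = s := by simp only [smul_eq_mul, hl]; field_simp; ring
  have ht : (1 - l) • α + l • β = t := by
    have : t = α + β - s := by linarith
    rw [this, ← hs]; simp only [smul_eq_mul]; ring
  have e1 := hc (mem_univ α) (mem_univ β) hl0 hl1 (by ring)
  have e2 := hc (mem_univ α) (mem_univ β) hl1 hl0 (by ring)
  rw [hs] at e1
  rw [ht] at e2
  simp only [smul_eq_mul] at e1 e2
  linarith

/-- The pointwise form of the submodularity of the Gagliardo energy. -/
lemma abs_sup_sub_rpow_add_abs_inf_sub_rpow_le {p : ℝ} (hp : 1 ≤ p) (a b c d : ℝ) :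
    |a ⊔ b - c ⊔ d| ^ p + |a ⊓ b - c ⊓ d| ^ p ≤ |a - c| ^ p + |b - d| ^ p := by
  rcases le_total a b with hab | hab <;> rcases le_total c d with hcd | hcd
  · simp only [sup_of_le_right hab, sup_of_le_right hcd, inf_of_le_left hab, inf_of_le_left hcd]
    linarith
  · simp only [sup_of_le_right hab, sup_of_le_left hcd, inf_of_le_left hab, inf_of_le_right hcd]
    rw [add_comm (|a - c| ^ p)]
    exact abs_rpow_add_le_of_between hp (by linarith) (by linarith) (by ring)
  · simp only [sup_of_le_left hab, sup_of_le_right hcd, inf_of_le_right hab, inf_of_le_left hcd]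
    exact abs_rpow_add_le_of_between hp (by linarith) (by linarith) (by ring)
  · simp only [sup_of_le_left hab, sup_of_le_left hcd, inf_of_le_right hab, inf_of_le_right hcd]
    linarith

/-- Cutting `a, c` down to the barrier `b, d` increases the pairing with the excess. -/
lemma oddPow_mul_excess_le {p : ℝ} (hp : 2 ≤ p) (a b c d : ℝ) :
    oddPow p (b - d) * ((a - a ⊓ b) - (c - c ⊓ d)) ≤
      oddPow p (a ⊓ b - c ⊓ d) * ((a - a ⊓ b) - (c - c ⊓ d)) := by
  have hm := monotone_oddPow hp
  rcases le_total a b with hab | hab <;> rcases le_total c d with hcd | hcd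
  · simp [inf_of_le_left hab, inf_of_le_left hcd]
  · simp only [inf_of_le_left hab, inf_of_le_right hcd]
    exact mul_le_mul_of_nonpos_right (hm (by linarith)) (by linarith)
  · simp only [inf_of_le_right hab, inf_of_le_left hcd]
    exact mul_le_mul_of_nonneg_right (hm (by linarith)) (by linarith)
  · simp [inf_of_le_right hab, inf_of_le_right hcd]

/-- The counterpart of `oddPow_mul_excess_le` for a barrier from below. -/
lemma oddPow_mul_deficit_le {p : ℝ} (hp : 2 ≤ p) (a b c d : ℝ) :
    oddPow p (a ⊔ b - c ⊔ d) * ((a ⊔ b - a) - (c ⊔ d - c)) ≤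
      oddPow p (b - d) * ((a ⊔ b - a) - (c ⊔ d - c)) := by
  have hm := monotone_oddPow hp
  rcases le_total a b with hab | hab <;> rcases le_total c d with hcd | hcd
  · simp [sup_of_le_right hab, sup_of_le_right hcd]
  · simp only [sup_of_le_right hab, sup_of_le_left hcd]
    exact mul_le_mul_of_nonneg_right (hm (by linarith)) (by linarith)
  · simp only [sup_of_le_left hab, sup_of_le_right hcd]
    exact mul_le_mul_of_nonpos_right (hm (by linarith)) (by linarith)
  · simp [sup_of_le_left hab, sup_of_le_left hcd]

/-! ### Minimizing submodular functionals -/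

/-- A submodular functional on a lattice of functions lying in an order interval attains its
minimum if its sublevel sets are closed under pointwise limits of sequences. Finite suprema of
almost-minimizers `u k` with defects `2⁻ᵏ` are almost-minimizers again, so `limsup u k`, reached by
two monotone limits, is a minimizer; no compactness is involved. -/
theorem exists_forall_le_of_submodular {X : Type*} (𝒦 : Set (X → ℝ)) (Φ : (X → ℝ) → ℝ)
    (hne : 𝒦.Nonempty) (a b : X → ℝ) (hab : ∀ w ∈ 𝒦, a ≤ w ∧ w ≤ b)
    (hsup : ∀ u ∈ 𝒦, ∀ v ∈ 𝒦, u ⊔ v ∈ 𝒦) (hinf : ∀ u ∈ 𝒦, ∀ v ∈ 𝒦, u ⊓ v ∈ 𝒦)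
    (hsub : ∀ u ∈ 𝒦, ∀ v ∈ 𝒦, Φ (u ⊔ v) + Φ (u ⊓ v) ≤ Φ u + Φ v)
    (hbdd : ∃ m : ℝ, ∀ w ∈ 𝒦, m ≤ Φ w)
    (hclosed : ∀ (w : ℕ → X → ℝ) (w' : X → ℝ) (C : ℝ), (∀ n, w n ∈ 𝒦) → (∀ n, Φ (w n) ≤ C) →
      (∀ x, Tendsto (fun n => w n x) atTop (𝓝 (w' x))) → w' ∈ 𝒦 ∧ Φ w' ≤ C) :
    ∃ u ∈ 𝒦, ∀ w ∈ 𝒦, Φ u ≤ Φ w := by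
  obtain ⟨m, hm⟩ := hbdd
  have hbelow : BddBelow (Φ '' 𝒦) := ⟨m, by rintro _ ⟨w, hw, rfl⟩; exact hm w hw⟩
  set I := sInf (Φ '' 𝒦) with hI
  have hIle : ∀ w ∈ 𝒦, I ≤ Φ w := fun w hw => csInf_le hbelow ⟨w, hw, rfl⟩
  have hex : ∀ n : ℕ, ∃ u ∈ 𝒦, Φ u ≤ I + (1 / 2) ^ n := fun n => by
    obtain ⟨_, ⟨u, hu, rfl⟩, h⟩ := exists_lt_of_csInf_lt (hne.image Φ)
      (lt_add_of_pos_right I (by positivity : (0 : ℝ) < (1 / 2) ^ n))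
    exact ⟨u, hu, h.le⟩
  choose u huK hu using hex
  have hP : ∀ n k : ℕ, partialSups (fun j => u (n + j)) k ∈ 𝒦 ∧
      Φ (partialSups (fun j => u (n + j)) k) ≤ I + (1 / 2) ^ n * (2 - (1 / 2) ^ k) := by
    intro n k
    induction k with
    | zero =>
      refine ⟨by simpa using huK n, ?_⟩
      have := hu n
      simp only [partialSups_zero, add_zero, pow_zero]
      linarith
    | succ k ih =>
      rw [partialSups_add_one]
      refine ⟨hsup _ ih.1 _ (huK _), ?_⟩
      have h1 := hsub _ ih.1 _ (huK (n + (k + 1)))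
      have h2 := hIle _ (hinf _ ih.1 _ (huK (n + (k + 1))))
      have h3 := hu (n + (k + 1))
      have h4 : ((1 : ℝ) / 2) ^ (n + (k + 1)) = (1 / 2) ^ n * ((1 / 2) ^ k * (1 / 2)) := by
        rw [pow_add, pow_succ]
      have h5 := ih.2
      rw [h4] at h3
      rw [pow_succ]
      linarith
  have hbd : ∀ (n : ℕ) (x : X), BddAbove (range fun j => u (n + j) x) := fun n x =>
    ⟨b x, by rintro _ ⟨j, rfl⟩; exact (hab _ (huK _)).2 x⟩
  set W : ℕ → X → ℝ := fun n x => ⨆ j, u (n + j) x with hW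
  have hWlim : ∀ n x, Tendsto (fun k => partialSups (fun j => u (n + j)) k x) atTop
      (𝓝 (W n x)) := by
    intro n x
    have e : ∀ k, partialSups (fun j => u (n + j)) k x = partialSups (fun j => u (n + j) x) k := by
      intro k
      induction k with
      | zero => simp
      | succ k ih => simp [partialSups_add_one, ih]
    simp only [e]
    have := tendsto_atTop_ciSup (partialSups (fun j => u (n + j) x)).monotone
      (bddAbove_range_partialSups.2 (hbd n x))
    rwa [ciSup_partialSups_eq (hbd n x)] at this
  have hWK : ∀ n, W n ∈ 𝒦 ∧ Φ (W n) ≤ I + (1 / 2) ^ n * 2 := fun n =>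
    hclosed _ _ _ (fun k => (hP n k).1) (fun k => (hP n k).2.trans (by
      have : (0 : ℝ) ≤ (1 / 2) ^ n * (1 / 2) ^ k := by positivity
      linarith)) (hWlim n)
  have hWanti : ∀ x, Antitone fun n => W n x := by
    intro x
    refine antitone_nat_of_succ_le fun n => ciSup_le fun j => ?_
    have := le_ciSup (hbd n x) (j + 1)
    simpa only [show n + (j + 1) = n + 1 + j by ring] using this
  have hWb : ∀ x, BddBelow (range fun n => W n x) := fun x =>
    ⟨a x, by rintro _ ⟨n, rfl⟩; exact (hab _ (hWK n).1).1 x⟩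
  set V : X → ℝ := fun x => ⨅ n, W n x with hV
  have hVlim : ∀ x, Tendsto (fun n => W n x) atTop (𝓝 (V x)) := fun x =>
    tendsto_atTop_ciInf (hWanti x) (hWb x)
  have hVK : ∀ n₀ : ℕ, V ∈ 𝒦 ∧ Φ V ≤ I + (1 / 2) ^ n₀ * 2 := fun n₀ =>
    hclosed (fun n => W (n + n₀)) V _ (fun n => (hWK _).1) (fun n => (hWK _).2.trans (by
      have : ((1 : ℝ) / 2) ^ (n + n₀) ≤ (1 / 2) ^ n₀ :=
        pow_le_pow_of_le_one (by norm_num) (by norm_num) (by omega)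
      linarith)) (fun x => (hVlim x).comp (tendsto_add_atTop_nat n₀))
  refine ⟨V, (hVK 0).1, fun w hw => (ge_of_tendsto' (x := atTop) ?_ fun n => (hVK n).2).trans
    (hIle w hw)⟩
  have := ((tendsto_pow_atTop_nhds_zero_of_lt_one (r := (1 / 2 : ℝ)) (by norm_num)
    (by norm_num)).mul_const 2).const_add I
  simpa using this

/-! ### The singular measure -/

/-- The increment `(x, y) ↦ w x - w y`. -/
def incr {X : Type*} (w : X → ℝ) (z : X × X) : ℝ := w z.1 - w z.2

@[fun_prop]
lemma measurable_incr {X : Type*} [MeasurableSpace X] {w : X → ℝ} (hw : Measurable w) :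
    Measurable (incr w) :=
  (hw.comp measurable_fst).sub (hw.comp measurable_snd)

variable {N : ℕ}

/-- The singular kernel `(x, y) ↦ |x - y|^{-d}`, with the value `0` on the diagonal. -/
noncomputable def kernel (d : ℝ) (z : Sp N × Sp N) : ℝ := (‖z.1 - z.2‖ ^ d)⁻¹

lemma kernel_nonneg (d : ℝ) (z : Sp N × Sp N) : 0 ≤ kernel d z := by
  unfold kernel; positivity

lemma kernel_swap (d : ℝ) (z : Sp N × Sp N) : kernel d z.swap = kernel d z := by
  simp [kernel, norm_sub_rev]

@[fun_prop]
lemma measurable_kernel (d : ℝ) : Measurable (kernel (N := N) d) := by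
  unfold kernel; fun_prop

/-- The measure `|x - y|^{-d} dx dy`. With `d = N + ps`, the `p`-th power of the Gagliardo seminorm
of `w` is the `p`-th power of the `L^p` norm of `incr w` for this measure. -/
noncomputable def kernelMeasure (N : ℕ) (d : ℝ) : Measure (Sp N × Sp N) :=
  volume.withDensity fun z => ENNReal.ofReal (kernel d z)

lemma integrable_kernelMeasure_iff {d : ℝ} {g : Sp N × Sp N → ℝ} :
    Integrable g (kernelMeasure N d) ↔ Integrable (fun z => kernel d z * g z) := by
  rw [kernelMeasure, integrable_withDensity_iff_integrable_smul' (by fun_prop)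
    (Eventually.of_forall fun _ => ENNReal.ofReal_lt_top)]
  simp only [ENNReal.toReal_ofReal (kernel_nonneg d _), smul_eq_mul]

lemma integrableOn_kernelMeasure_iff {d : ℝ} {g : Sp N × Sp N → ℝ} {S : Set (Sp N × Sp N)}
    (hS : MeasurableSet S) :
    IntegrableOn g S (kernelMeasure N d) ↔ IntegrableOn (fun z => kernel d z * g z) S := by
  rw [IntegrableOn, IntegrableOn, kernelMeasure, restrict_withDensity hS,
    integrable_withDensity_iff_integrable_smul' (by fun_prop)
    (Eventually.of_forall fun _ => ENNReal.ofReal_lt_top)]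
  simp only [ENNReal.toReal_ofReal (kernel_nonneg d _), smul_eq_mul]

lemma integral_kernelMeasure (d : ℝ) (g : Sp N × Sp N → ℝ) :
    ∫ z, g z ∂(kernelMeasure N d) = ∫ z, kernel d z * g z := by
  rw [kernelMeasure, integral_withDensity_eq_integral_toReal_smul (by fun_prop)
    (Eventually.of_forall fun _ => ENNReal.ofReal_lt_top)]
  simp only [ENNReal.toReal_ofReal (kernel_nonneg d _), smul_eq_mul]

lemma pairing_eq_integral (s p : ℝ) (u v : Sp N → ℝ) :
    pairing s p u v =
      ∫ z, oddPow p (incr u z) * incr v z ∂(kernelMeasure N ((N : ℝ) + p * s)) := by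
  rw [integral_kernelMeasure, pairing]
  congr 1
  ext z
  simp only [kernel, oddPow, incr, div_eq_mul_inv]
  ring

lemma pairing_congr {s p : ℝ} {u u' v v' : Sp N → ℝ} (hu : u =ᵐ[volume] u')
    (hv : v =ᵐ[volume] v') : pairing s p u v = pairing s p u' v' := by
  refine integral_congr_ae ?_
  have q1 : Measure.QuasiMeasurePreserving (Prod.fst : Sp N × Sp N → Sp N) volume volume :=
    Measure.quasiMeasurePreserving_fst
  have q2 : Measure.QuasiMeasurePreserving (Prod.snd : Sp N × Sp N → Sp N) volume volume :=
    Measure.quasiMeasurePreserving_snd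
  filter_upwards [q1.ae hu, q2.ae hu, q1.ae hv, q2.ae hv] with z h1 h2 h3 h4
  rw [h1, h2, h3, h4]

lemma memW_congr {s p : ℝ} {U : Set (Sp N)} {u u' : Sp N → ℝ} (hu : u =ᵐ[volume] u')
    (h : MemW s p U u) : MemW s p U u' := by
  refine ⟨(memLp_congr_ae (ae_restrict_of_ae hu)).1 h.1, ?_⟩
  have q1 : Measure.QuasiMeasurePreserving (Prod.fst : Sp N × Sp N → Sp N) volume volume :=
    Measure.quasiMeasurePreserving_fst
  have q2 : Measure.QuasiMeasurePreserving (Prod.snd : Sp N × Sp N → Sp N) volume volume :=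
    Measure.quasiMeasurePreserving_snd
  have : gagliardo s p U u' = gagliardo s p U u := by
    refine lintegral_congr_ae (ae_restrict_of_ae ?_)
    filter_upwards [q1.ae hu, q2.ae hu] with z h1 h2
    rw [h1, h2]
  rw [this]
  exact h.2

/-- Membership in `W^{s,p}(U)` in terms of integrable functions. -/
lemma memW_iff {s p : ℝ} (hp : 0 < p) {U : Set (Sp N)} (hU : MeasurableSet U) {w : Sp N → ℝ}
    (hw : Measurable w) :
    MemW s p U w ↔ IntegrableOn (fun x => |w x| ^ p) U ∧
      IntegrableOn (fun z => |incr w z| ^ p) (U ×ˢ U) (kernelMeasure N ((N : ℝ) + p * s)) := by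
  refine and_congr ?_ ?_
  · rw [← integrable_norm_rpow_iff hw.aestronglyMeasurable (by simpa using hp) (by simp),
      ENNReal.toReal_ofReal hp.le]
    rfl
  · rw [integrableOn_kernelMeasure_iff (hU.prod hU), IntegrableOn, Integrable,
      hasFiniteIntegral_iff_ofReal (Eventually.of_forall fun z =>
        mul_nonneg (kernel_nonneg _ z) (by positivity))]
    have hm : Measurable fun z : Sp N × Sp N => kernel ((N : ℝ) + p * s) z * |incr w z| ^ p := by
      fun_prop
    rw [and_iff_right hm.aestronglyMeasurable]
    simp only [gagliardo, kernel, incr, div_eq_inv_mul]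

/-! ### Kernel estimates and functions supported away from the complement of a set -/

lemma integrable_one_add_norm_rpow {d : ℝ} (hd : (N : ℝ) < d) :
    Integrable fun x : Sp N => (1 + ‖x‖) ^ (-d) :=
  integrable_one_add_norm (by simpa using hd)

lemma kernel_le_of_le_norm_sub {d R δ : ℝ} (hd : 0 ≤ d) (hδ : 0 < δ) {x y : Sp N}
    (hx : ‖x‖ ≤ R) (hxy : δ ≤ ‖x - y‖) :
    kernel d (x, y) ≤ ((1 + R) / δ + 1) ^ d * (1 + ‖y‖) ^ (-d) := by
  have h0 : 0 < ‖x - y‖ := hδ.trans_le hxy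
  have hR : 0 ≤ R := (norm_nonneg x).trans hx
  have h1 : 1 + ‖y‖ ≤ ((1 + R) / δ + 1) * ‖x - y‖ := by
    have h2 : ‖y‖ ≤ ‖x‖ + ‖x - y‖ := by
      rw [norm_sub_rev]
      calc ‖y‖ = ‖x + (y - x)‖ := by congr 1; abel
        _ ≤ _ := norm_add_le _ _
    have h3 : 1 + R ≤ (1 + R) / δ * ‖x - y‖ := by
      rw [div_mul_eq_mul_div, le_div_iff₀ hδ]
      exact mul_le_mul_of_nonneg_left hxy (by linarith)
    linarith
  rw [kernel, Real.rpow_neg (by positivity), ← div_eq_mul_inv, le_div_iff₀ (by positivity),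
    inv_mul_le_iff₀ (by positivity), ← Real.mul_rpow (by positivity) (by positivity)]
  exact Real.rpow_le_rpow (by positivity) (h1.trans_eq (mul_comm _ _)) hd

/-- A function on `ℝ^N × ℝ^N` which is integrable on `U × U` for the singular measure and which
elsewhere is bounded by `A x * B y + A y * B x`, where `A` lives on a bounded set at positive
distance from the complement of `U`, is integrable: off `U × U` the singularity is not seen. -/
lemma integrable_kernelMeasure_of_le_off {d R δ : ℝ} (hd : 0 ≤ d) (hδ : 0 < δ)
    {Ω U : Set (Sp N)} (hU : MeasurableSet U) (hR : ∀ x ∈ Ω, ‖x‖ ≤ R)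
    (hdist : ∀ x ∈ Ω, ∀ y ∉ U, δ ≤ ‖x - y‖) {g : Sp N × Sp N → ℝ} (hg : Measurable g)
    (hgU : IntegrableOn g (U ×ˢ U) (kernelMeasure N d)) {A B : Sp N → ℝ} (hA0 : ∀ x, 0 ≤ A x)
    (hB0 : ∀ x, 0 ≤ B x) (hAΩ : ∀ x ∉ Ω, A x = 0) (hA : Integrable A)
    (hB : Integrable fun x => B x * (1 + ‖x‖) ^ (-d))
    (hle : ∀ z ∉ U ×ˢ U, |g z| ≤ A z.1 * B z.2 + A z.2 * B z.1) :
    Integrable g (kernelMeasure N d) := by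
  rw [integrable_kernelMeasure_iff]
  rw [integrableOn_kernelMeasure_iff (hU.prod hU),
    ← integrable_indicator_iff (hU.prod hU)] at hgU
  set C := ((1 + R) / δ + 1) ^ d with hC
  have hH : Integrable fun z : Sp N × Sp N => (C * A z.1) * (B z.2 * (1 + ‖z.2‖) ^ (-d)) :=
    (hA.const_mul C).mul_prod hB
  have hΩU : ∀ x ∈ Ω, x ∈ U := fun x hx => by
    by_contra h
    have := hdist x hx x h
    simp at this
    linarith
  have hfar : ∀ z : Sp N × Sp N, z ∉ U ×ˢ U → kernel d z * (A z.1 * B z.2) ≤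
      (C * A z.1) * (B z.2 * (1 + ‖z.2‖) ^ (-d)) := by
    intro z hz
    by_cases h1 : z.1 ∈ Ω
    · have h2 : z.2 ∉ U := fun h => hz ⟨hΩU _ h1, h⟩
      have h3 := kernel_le_of_le_norm_sub hd hδ (hR _ h1) (hdist _ h1 _ h2)
      calc kernel d z * (A z.1 * B z.2) ≤ (C * (1 + ‖z.2‖) ^ (-d)) * (A z.1 * B z.2) :=
            mul_le_mul_of_nonneg_right h3 (mul_nonneg (hA0 _) (hB0 _))
        _ = _ := by ring
    · simp [hAΩ _ h1]
  have hH' := hH.swap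
  refine ((hgU.norm.add hH).add hH').mono' (by fun_prop) (Eventually.of_forall fun z => ?_)
  -- If `Ω` is empty, nothing prevents `R`, and with it `C`, from being negative.
  have hC0 : 0 ≤ C ∨ ∀ x, A x = 0 := by
    by_cases h : ∃ x, x ∈ Ω
    · obtain ⟨x, hx⟩ := h
      have := (norm_nonneg x).trans (hR x hx)
      left; positivity
    · right; intro x; exact hAΩ x fun hx => h ⟨x, hx⟩
  have hHn : ∀ z : Sp N × Sp N, 0 ≤ (C * A z.1) * (B z.2 * (1 + ‖z.2‖) ^ (-d)) := fun z => by
    refine mul_nonneg ?_ (mul_nonneg (hB0 _) (by positivity))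
    rcases hC0 with h | h
    · exact mul_nonneg h (hA0 _)
    · simp [h]
  have e1 := hHn z
  have e2 := hHn z.swap
  simp only [Function.comp, Pi.add_apply]
  by_cases hz : z ∈ U ×ˢ U
  · rw [indicator_of_mem hz]; linarith
  · have hz' : z.swap ∉ U ×ˢ U := fun h => hz ⟨h.2, h.1⟩
    rw [indicator_of_notMem hz, norm_zero, zero_add, norm_mul, Real.norm_eq_abs,
      abs_of_nonneg (kernel_nonneg d z)]
    calc kernel d z * ‖g z‖ ≤ kernel d z * (A z.1 * B z.2 + A z.2 * B z.1) :=
          mul_le_mul_of_nonneg_left (hle z hz) (kernel_nonneg d z)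
      _ = kernel d z * (A z.1 * B z.2) + kernel d z.swap * (A z.swap.1 * B z.swap.2) := by
          rw [kernel_swap]; simp; ring
      _ ≤ _ := add_le_add (hfar z hz) (hfar z.swap hz')

/-- Functions of `W^{s,p}(U)` supported away from the complement of `U` are in `W^{s,p}(ℝ^N)`. -/
lemma integrable_incr_rpow_of_support {d p R δ : ℝ} (hp : 0 < p) (hd : (N : ℝ) < d) (hδ : 0 < δ)
    {Ω U : Set (Sp N)} (hU : MeasurableSet U) (hR : ∀ x ∈ Ω, ‖x‖ ≤ R)
    (hdist : ∀ x ∈ Ω, ∀ y ∉ U, δ ≤ ‖x - y‖) {w : Sp N → ℝ} (hw : Measurable w)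
    (hwΩ : ∀ x ∉ Ω, w x = 0) (hwL : IntegrableOn (fun x => |w x| ^ p) U)
    (hwU : IntegrableOn (fun z => |incr w z| ^ p) (U ×ˢ U) (kernelMeasure N d)) :
    Integrable (fun x => |w x| ^ p) ∧
      Integrable (fun z => |incr w z| ^ p) (kernelMeasure N d) := by
  have hΩU : ∀ x ∉ U, w x = 0 := fun x hx => hwΩ x fun h => by
    have := hdist x h x hx
    simp at this
    linarith
  have hL : Integrable (fun x => |w x| ^ p) := by
    rw [← integrableOn_univ, ← union_compl_self U]
    refine hwL.union ((integrableOn_congr_fun (fun x hx => ?_) hU.compl).2 integrableOn_zero)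
    simp [hΩU x hx, Real.zero_rpow hp.ne']
  refine ⟨hL, integrable_kernelMeasure_of_le_off (A := fun x => |w x| ^ p) (B := fun _ => 1)
    (le_trans (by positivity) hd.le) hδ hU hR hdist (by fun_prop) hwU (fun x => by positivity)
    (by simp) (fun x hx => by simp [hwΩ x hx, Real.zero_rpow hp.ne']) hL
    (by simpa using integrable_one_add_norm_rpow hd) fun z hz => ?_⟩
  have h0 : 0 ≤ |w z.1| ^ p := by positivity
  have h0' : 0 ≤ |w z.2| ^ p := by positivity
  rw [abs_of_nonneg (by positivity), incr]
  by_cases h1 : z.1 ∈ U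
  · have h2 : z.2 ∉ U := fun h => hz ⟨h1, h⟩
    simp [hΩU _ h2, Real.zero_rpow hp.ne']
  · simp [hΩU _ h1, Real.zero_rpow hp.ne']

/-- The kernel is integrable against `p`-th powers of Lipschitz truncated increments. -/
lemma integrable_min_mul_norm_rpow (hN : 0 < N) {d p L : ℝ} (hp : 0 < p) (hd : (N : ℝ) < d)
    (hdp : d < N + p) (hL : 0 ≤ L) :
    Integrable fun x : Sp N => (min 1 (L * ‖x‖)) ^ p * (‖x‖ ^ d)⁻¹ := by
  have : Nonempty (Fin N) := ⟨⟨0, hN⟩⟩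
  have hmeas : Measurable fun x : Sp N => (min 1 (L * ‖x‖)) ^ p * (‖x‖ ^ d)⁻¹ := by fun_prop
  have hin : IntegrableOn (fun x : Sp N => L ^ p * ‖x‖ ^ (p - d)) (Metric.ball 0 1) := by
    refine Integrable.const_mul ?_ _
    refine (integrableOn_fun_norm_addHaar volume (f := fun r => r ^ (p - d)) (r := 1)).2 ?_
    have : IntegrableOn (fun y : ℝ => y ^ ((N : ℝ) - 1 + (p - d))) (Ioo 0 1) := by
      have := intervalIntegral.intervalIntegrable_rpow' (a := 0) (b := 1)
        (r := (N : ℝ) - 1 + (p - d)) (by linarith)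
      rw [intervalIntegrable_iff_integrableOn_Ioo_of_le zero_le_one] at this
      exact this
    refine (integrableOn_congr_fun (fun y hy => ?_) measurableSet_Ioo).1 this
    simp only [finrank_euclideanSpace, Fintype.card_fin, smul_eq_mul]
    rw [Real.rpow_add hy.1, ← Real.rpow_natCast, Nat.cast_sub hN, Nat.cast_one]
  have hout : Integrable fun x : Sp N => (2 : ℝ) ^ d * (1 + ‖x‖) ^ (-d) :=
    (integrable_one_add_norm_rpow hd).const_mul _
  have hd0 : 0 ≤ d := le_trans (by positivity) hd.le
  refine (((integrable_indicator_iff Metric.isOpen_ball.measurableSet).2 hin).add hout).mono'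
    hmeas.aestronglyMeasurable (Eventually.of_forall fun x => ?_)
  have hm0 : 0 ≤ min 1 (L * ‖x‖) := le_min zero_le_one (by positivity)
  have ho : 0 ≤ (2 : ℝ) ^ d * (1 + ‖x‖) ^ (-d) := by positivity
  rw [Real.norm_of_nonneg (by positivity)]
  simp only [Pi.add_apply]
  by_cases hx : x ∈ Metric.ball (0 : Sp N) 1
  · rw [indicator_of_mem hx]
    suffices (min 1 (L * ‖x‖)) ^ p * (‖x‖ ^ d)⁻¹ ≤ L ^ p * ‖x‖ ^ (p - d) by linarith
    rcases eq_or_ne x 0 with rfl | h0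
    · simp [Real.zero_rpow hp.ne']; positivity
    · have hx0 : 0 < ‖x‖ := norm_pos_iff.2 h0
      rw [Real.rpow_sub hx0, div_eq_mul_inv, ← mul_assoc, ← Real.mul_rpow hL hx0.le]
      exact mul_le_mul_of_nonneg_right
        (Real.rpow_le_rpow hm0 (min_le_right _ _) hp.le) (by positivity)
  · rw [indicator_of_notMem hx, zero_add]
    have hx1 : 1 ≤ ‖x‖ := by simpa using hx
    have h1 : (min 1 (L * ‖x‖)) ^ p ≤ 1 := Real.rpow_le_one hm0 (min_le_left _ _) hp.le
    calc (min 1 (L * ‖x‖)) ^ p * (‖x‖ ^ d)⁻¹ ≤ 1 * (‖x‖ ^ d)⁻¹ :=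
          mul_le_mul_of_nonneg_right h1 (by positivity)
      _ ≤ _ := by
          rw [one_mul, Real.rpow_neg (by positivity), ← div_eq_mul_inv,
            inv_le_comm₀ (by positivity) (by positivity), inv_div,
            ← Real.div_rpow (by positivity) (by positivity)]
          exact Real.rpow_le_rpow (by positivity) (by linarith) hd0

/-- Multiplication by a Lipschitz cutoff with values in `[0, 1]` preserves `W^{s,p}(U)`. -/
lemma integrableOn_incr_mul_rpow (hN : 0 < N) {d p L : ℝ} (hp : 0 < p) (hd : (N : ℝ) < d)
    (hdp : d < N + p) (hL : 0 ≤ L) {U : Set (Sp N)} (hU : MeasurableSet U) {w η : Sp N → ℝ}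
    (hw : Measurable w) (hη : Measurable η) (hη0 : ∀ x, 0 ≤ η x) (hη1 : ∀ x, η x ≤ 1)
    (hηL : ∀ x y, |η x - η y| ≤ L * ‖x - y‖) (hwL : IntegrableOn (fun x => |w x| ^ p) U)
    (hwU : IntegrableOn (fun z => |incr w z| ^ p) (U ×ˢ U) (kernelMeasure N d)) :
    IntegrableOn (fun z => |incr (fun x => η x * w x) z| ^ p) (U ×ˢ U) (kernelMeasure N d) := by
  have hp0 := hp.le
  rw [integrableOn_kernelMeasure_iff (hU.prod hU)] at hwU ⊢
  have hconv := Integrable.convolution_integrand (ContinuousLinearMap.mul ℝ ℝ)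
    ((integrable_indicator_iff hU).2 hwL)
    (integrable_min_mul_norm_rpow hN hp hd hdp hL)
  refine ((hwU.add hconv.integrableOn).const_mul (2 ^ p)).mono'
    (by fun_prop) ((ae_restrict_iff' (hU.prod hU)).2 (Eventually.of_forall fun z hz => ?_))
  have hk := kernel_nonneg d z
  have hz2 : z.2 ∈ U := hz.2
  rw [Real.norm_of_nonneg (mul_nonneg hk (by positivity))]
  simp only [Pi.add_apply, ContinuousLinearMap.mul_apply', indicator_of_mem hz2]
  have e : incr (fun x => η x * w x) z = η z.1 * incr w z + (η z.1 - η z.2) * w z.2 := by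
    simp only [incr]; ring
  have h1 : |η z.1 * incr w z| ^ p ≤ |incr w z| ^ p := by
    refine Real.rpow_le_rpow (abs_nonneg _) ?_ hp0
    rw [abs_mul, abs_of_nonneg (hη0 _)]
    exact mul_le_of_le_one_left (abs_nonneg _) (hη1 _)
  have h2 : |(η z.1 - η z.2) * w z.2| ^ p ≤ (min 1 (L * ‖z.1 - z.2‖)) ^ p * |w z.2| ^ p := by
    rw [abs_mul, Real.mul_rpow (abs_nonneg _) (abs_nonneg _)]
    refine mul_le_mul_of_nonneg_right (Real.rpow_le_rpow (abs_nonneg _)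
      (le_min ?_ (hηL _ _)) hp0) (by positivity)
    rw [abs_le]
    constructor <;> linarith [hη0 z.1, hη0 z.2, hη1 z.1, hη1 z.2]
  calc kernel d z * |incr (fun x => η x * w x) z| ^ p
      ≤ kernel d z * (2 ^ p * (|incr w z| ^ p +
          (min 1 (L * ‖z.1 - z.2‖)) ^ p * |w z.2| ^ p)) := by
        refine mul_le_mul_of_nonneg_left ?_ hk
        rw [e]
        refine (abs_add_rpow_le hp0 _ _).trans (mul_le_mul_of_nonneg_left ?_ (by positivity))
        exact add_le_add h1 h2
    _ = _ := by simp only [kernel]; ring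

/-! ### Subcritical fractional Sobolev embedding -/

/-- The mass of the kernel outside a set of measure `a` is at least a multiple of `a^{1 - d/N}`,
wherever the kernel is centred: a ball of measure `2a` has at least half of its measure outside. -/
lemma exists_le_lintegral_kernel_compl (hN : 0 < N) {d : ℝ} (hd : 0 ≤ d) :
    ∃ c : ℝ, 0 < c ∧ ∀ (A : Set (Sp N)) (a : ℝ), MeasurableSet A → 0 < a →
      volume A = ENNReal.ofReal a → ∀ x : Sp N,
        ENNReal.ofReal (c * a ^ (1 - d / N)) ≤
          ∫⁻ y in Aᶜ, ENNReal.ofReal (kernel d (x, y)) := by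
  have : Nonempty (Fin N) := ⟨⟨0, hN⟩⟩
  have hN' : (N : ℝ) ≠ 0 := by positivity
  set ω := (volume (Metric.ball (0 : Sp N) 1)).toReal with hω
  have hωpos : 0 < ω := ENNReal.toReal_pos (Metric.measure_ball_pos volume _ one_pos).ne'
    measure_ball_lt_top.ne
  refine ⟨(2 / ω) ^ (-(d / N)), by positivity, fun A a hA ha hAa x => ?_⟩
  set ρ : ℝ := (2 * a / ω) ^ (1 / (N : ℝ)) with hρ
  have hρpos : 0 < ρ := by positivity
  have hball : volume (Metric.ball x ρ) = ENNReal.ofReal (2 * a) := by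
    rw [Measure.addHaar_ball_of_pos volume x hρpos, finrank_euclideanSpace, Fintype.card_fin,
      ← ENNReal.ofReal_toReal (measure_ball_lt_top (μ := volume) (x := (0 : Sp N)) (r := 1)).ne,
      ← ENNReal.ofReal_mul (by positivity), ← hω, hρ, ← Real.rpow_natCast,
      ← Real.rpow_mul (by positivity), one_div_mul_cancel hN', Real.rpow_one]
    congr 1; field_simp
  -- The centre is removed because the kernel takes the value `0`, not `∞`, on the diagonal.
  have hdiff : ENNReal.ofReal a ≤ volume ((Metric.ball x ρ \ A) \ {x}) := by
    rw [measure_sdiff_null (measure_singleton x)]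
    refine le_trans ?_ (le_measure_sdiff (μ := volume))
    rw [hball, hAa, ← ENNReal.ofReal_sub _ ha.le]
    exact ENNReal.ofReal_le_ofReal (by linarith)
  have hk : ∀ y ∈ (Metric.ball x ρ \ A) \ {x}, ENNReal.ofReal ((ρ ^ d)⁻¹) ≤
      ENNReal.ofReal (kernel d (x, y)) := by
    rintro y ⟨⟨hy, -⟩, hyx⟩
    refine ENNReal.ofReal_le_ofReal ?_
    have h0 : 0 < ‖x - y‖ := norm_pos_iff.2 (sub_ne_zero.2 (Ne.symm hyx))
    have h1 : ‖x - y‖ ≤ ρ := by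
      rw [norm_sub_rev, ← dist_eq_norm]; exact (Metric.mem_ball.1 hy).le
    exact inv_anti₀ (by positivity) (Real.rpow_le_rpow h0.le h1 hd)
  calc ENNReal.ofReal ((2 / ω) ^ (-(d / N)) * a ^ (1 - d / N))
      = ENNReal.ofReal ((ρ ^ d)⁻¹) * ENNReal.ofReal a := by
        rw [← ENNReal.ofReal_mul (by positivity), hρ, ← Real.rpow_mul (by positivity),
          ← Real.rpow_neg (by positivity), show 2 * a / ω = 2 / ω * a by ring,
          Real.mul_rpow (by positivity) ha.le, show 1 - d / N = -(d / N) + 1 by ring,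
          Real.rpow_add_one ha.ne', show -(1 / (N : ℝ) * d) = -(d / N) by ring]
        ring_nf
    _ ≤ ENNReal.ofReal ((ρ ^ d)⁻¹) * volume ((Metric.ball x ρ \ A) \ {x}) :=
        mul_le_mul_right hdiff _
    _ ≤ ∫⁻ y in (Metric.ball x ρ \ A) \ {x}, ENNReal.ofReal (kernel d (x, y)) := by
        rw [← setLIntegral_const]
        exact setLIntegral_mono' ((Metric.isOpen_ball.measurableSet.diff hA).diff
          (measurableSet_singleton x)) hk
    _ ≤ _ := lintegral_mono_set fun y hy => hy.1.2

lemma measurableSet_lt_abs {w : Sp N → ℝ} (hw : Measurable w) (t : ℝ) :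
    MeasurableSet {x | t < |w x|} :=
  measurableSet_lt measurable_const hw.abs

lemma measure_lt_abs_ne_top {p t : ℝ} (hp : 0 < p) (ht : 0 < t) {w : Sp N → ℝ}
    (hL : Integrable fun x => |w x| ^ p) : volume {x | t < |w x|} ≠ ∞ := by
  have h := hL.measure_ge_lt_top (Real.rpow_pos_of_pos ht p)
  refine ((measure_mono fun x hx => ?_).trans_lt h).ne
  exact Real.rpow_le_rpow ht.le (le_of_lt hx) hp.le

/-- The energy of `w` controls the decay of its distribution function: `|w x - w y| ≥ t` whenever
`|w x| > 2t` and `|w y| ≤ t`. -/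
lemma exists_measureReal_lt_abs_le (hN : 0 < N) {d p : ℝ} (hp : 0 < p) (hd : (N : ℝ) < d)
    {w : Sp N → ℝ} (hw : Measurable w) (hL : Integrable fun x => |w x| ^ p)
    (hE : Integrable (fun z => |incr w z| ^ p) (kernelMeasure N d)) :
    ∃ C : ℝ, 0 ≤ C ∧ ∀ t : ℝ, 0 < t → (volume {x | 2 * t < |w x|}).toReal ≤
      C * t ^ (-p) * (volume {x | t < |w x|}).toReal ^ (d / N - 1) := by
  have hN' : (0 : ℝ) < N := by positivity
  obtain ⟨c, hc, hker⟩ := exists_le_lintegral_kernel_compl hN (hN'.trans hd).le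
  rw [integrable_kernelMeasure_iff] at hE
  set E := ∫ z, kernel d z * |incr w z| ^ p with hEdef
  have hE0 : 0 ≤ E := integral_nonneg fun z => mul_nonneg (kernel_nonneg d z) (by positivity)
  refine ⟨E / c, by positivity, fun t ht => ?_⟩
  set A := {x | t < |w x|} with hA
  set B := {x | 2 * t < |w x|} with hB
  have hAm : MeasurableSet A := measurableSet_lt_abs hw t
  have hBm : MeasurableSet B := measurableSet_lt_abs hw (2 * t)
  have hAfin : volume A ≠ ∞ := measure_lt_abs_ne_top hp ht hL
  have hBfin : volume B ≠ ∞ := measure_lt_abs_ne_top hp (by linarith) hL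
  have hBA : B ⊆ A := fun x (hx : 2 * t < |w x|) => by
    show t < |w x|
    linarith
  set a := (volume A).toReal with ha
  set b := (volume B).toReal with hb
  have hba : b ≤ a := ENNReal.toReal_mono hAfin (measure_mono hBA)
  have hθ : 0 < d / N - 1 := by rw [sub_pos, one_lt_div hN']; exact hd
  have ha0 : 0 ≤ a := ENNReal.toReal_nonneg
  rcases ha0.eq_or_lt with h0 | hapos
  · rw [← h0, Real.zero_rpow hθ.ne', mul_zero]; linarith
  have hmain : ENNReal.ofReal (b * (t ^ p * (c * a ^ (1 - d / N)))) ≤ ENNReal.ofReal E := by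
    calc ENNReal.ofReal (b * (t ^ p * (c * a ^ (1 - d / N))))
        = ∫⁻ _ in B, ENNReal.ofReal (t ^ p) * ENNReal.ofReal (c * a ^ (1 - d / N)) := by
          rw [setLIntegral_const, ENNReal.ofReal_mul ENNReal.toReal_nonneg,
            ENNReal.ofReal_mul (by positivity), ENNReal.ofReal_toReal hBfin, mul_comm]
      _ ≤ ∫⁻ x in B, ∫⁻ y in Aᶜ, ENNReal.ofReal (kernel d (x, y) * |incr w (x, y)| ^ p) := by
          refine setLIntegral_mono' hBm fun x hx => ?_
          calc _ ≤ ENNReal.ofReal (t ^ p) * ∫⁻ y in Aᶜ, ENNReal.ofReal (kernel d (x, y)) := by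
                gcongr
                exact hker A a hAm hapos (ENNReal.ofReal_toReal hAfin).symm x
            _ = ∫⁻ y in Aᶜ, ENNReal.ofReal (t ^ p) * ENNReal.ofReal (kernel d (x, y)) := by
                rw [lintegral_const_mul]
                exact ((measurable_kernel d).comp measurable_prodMk_left).ennreal_ofReal
            _ ≤ _ := by
                refine setLIntegral_mono' hAm.compl fun y hy => ?_
                rw [← ENNReal.ofReal_mul (by positivity), mul_comm]
                refine ENNReal.ofReal_le_ofReal (mul_le_mul_of_nonneg_left ?_ (kernel_nonneg _ _))
                refine Real.rpow_le_rpow ht.le ?_ hp.le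
                have h1 : 2 * t < |w x| := hx
                have h2 : |w y| ≤ t := not_lt.1 hy
                have h3 := abs_sub_abs_le_abs_sub (w x) (w y)
                simp only [incr]
                linarith
      _ ≤ ∫⁻ x, ∫⁻ y, ENNReal.ofReal (kernel d (x, y) * |incr w (x, y)| ^ p) :=
          (setLIntegral_le_lintegral _ _).trans
            (lintegral_mono fun x => setLIntegral_le_lintegral _ _)
      _ = ∫⁻ z, ENNReal.ofReal (kernel d z * |incr w z| ^ p) := by
          rw [Measure.volume_eq_prod, lintegral_prod]
          exact Measurable.aemeasurable (by fun_prop)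
      _ = ENNReal.ofReal E := by
          rw [hEdef, ofReal_integral_eq_lintegral_ofReal hE]
          exact Eventually.of_forall fun z => mul_nonneg (kernel_nonneg d z) (by positivity)
  have hmain' := (ENNReal.ofReal_le_ofReal_iff hE0).1 hmain
  rw [show 1 - d / N = -(d / N - 1) by ring, Real.rpow_neg hapos.le] at hmain'
  rw [Real.rpow_neg ht.le]
  have ht' : 0 < t ^ p := by positivity
  have ha' : 0 < a ^ (d / N - 1) := by positivity
  have e : E / c * (t ^ p)⁻¹ * a ^ (d / N - 1) =
      E / (t ^ p * (c * (a ^ (d / N - 1))⁻¹)) := by field_simp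
  rw [e, le_div_iff₀ (by positivity)]
  exact hmain'

/-- A sublinear recursion for the measures of dyadic level sets gives power decay at the fixed
point `p / (1 - θ)` of `γ ↦ p + θ γ`. -/
lemma exists_le_mul_rpow_of_recursion {a : ℕ → ℝ} {C p θ : ℝ} (ha : ∀ k, 0 ≤ a k) (hC : 0 ≤ C)
    (hθ0 : 0 ≤ θ) (hθ1 : θ < 1)
    (hrec : ∀ k, a (k + 1) ≤ C * ((2 : ℝ) ^ k) ^ (-p) * a k ^ θ) :
    ∃ M : ℝ, ∀ k, a k ≤ M * ((2 : ℝ) ^ k) ^ (-(p / (1 - θ))) := by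
  have h1θ : 0 < 1 - θ := by linarith
  set γ := p / (1 - θ) with hγ
  have hfix : p + γ * θ = γ := by rw [hγ]; field_simp; ring
  set D := C * (2 : ℝ) ^ γ with hD
  have hD0 : 0 ≤ D := by positivity
  -- The invariant `a k ≤ M 2^{-kγ}` is preserved as soon as `D M^θ ≤ M`.
  set M := max (a 0) (D ^ (1 / (1 - θ))) with hM
  have hM0 : 0 ≤ M := le_max_of_le_left (ha 0)
  have hDM : D * M ^ θ ≤ M := by
    have h1 : D ≤ M ^ (1 - θ) := by
      calc D = (D ^ (1 / (1 - θ))) ^ (1 - θ) := by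
            rw [← Real.rpow_mul hD0, one_div_mul_cancel h1θ.ne', Real.rpow_one]
        _ ≤ M ^ (1 - θ) := Real.rpow_le_rpow (by positivity) (le_max_right _ _) h1θ.le
    rcases hM0.eq_or_lt with h0 | h0
    · rw [← h0, Real.zero_rpow h1θ.ne'] at h1
      have : D = 0 := le_antisymm h1 hD0
      rw [this, zero_mul]; exact hM0
    · calc D * M ^ θ ≤ M ^ (1 - θ) * M ^ θ := mul_le_mul_of_nonneg_right h1 (by positivity)
        _ = M := by rw [← Real.rpow_add h0]; simp
  refine ⟨M, fun k => ?_⟩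
  induction k with
  | zero =>
    have h0 : a 0 ≤ M := le_max_left _ _
    simpa using h0
  | succ k ih =>
    have h2k : (0 : ℝ) < 2 ^ k := by positivity
    calc a (k + 1) ≤ C * ((2 : ℝ) ^ k) ^ (-p) * (M * ((2 : ℝ) ^ k) ^ (-γ)) ^ θ := by
          refine (hrec k).trans (mul_le_mul_of_nonneg_left ?_ (by positivity))
          exact Real.rpow_le_rpow (ha k) ih hθ0
      _ = C * M ^ θ * ((2 : ℝ) ^ k) ^ (-γ) := by
          rw [Real.mul_rpow hM0 (by positivity), ← Real.rpow_mul h2k.le]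
          have : ((2 : ℝ) ^ k) ^ (-γ) = ((2 : ℝ) ^ k) ^ (-p) * ((2 : ℝ) ^ k) ^ (-γ * θ) := by
            rw [← Real.rpow_add h2k]; congr 1; linarith
          rw [this]; ring
      _ = D * M ^ θ * ((2 : ℝ) ^ (k + 1)) ^ (-γ) := by
          rw [pow_succ, Real.mul_rpow h2k.le (by norm_num), hD,
            Real.rpow_neg (by norm_num : (0 : ℝ) ≤ 2)]
          have : (2 : ℝ) ^ γ ≠ 0 := by positivity
          field_simp
      _ ≤ _ := mul_le_mul_of_nonneg_right hDM (by positivity)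

/-- Power decay of the distribution function gives integrability of all smaller powers. -/
lemma integrable_abs_rpow_of_measure_le {p q γ M : ℝ} (hp : 0 < p) (hpq : p ≤ q) (hqγ : q < γ)
    {w : Sp N → ℝ} (hw : Measurable w) (hL : Integrable fun x => |w x| ^ p)
    (hM : ∀ k : ℕ, (volume {x | (2 : ℝ) ^ k < |w x|}).toReal ≤ M * ((2 : ℝ) ^ k) ^ (-γ)) :
    Integrable fun x => |w x| ^ q := by
  have hq : 0 < q := hp.trans_le hpq
  refine ⟨(by fun_prop : Measurable fun x => |w x| ^ q).aestronglyMeasurable, ?_⟩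
  rw [hasFiniteIntegral_iff_ofReal (Eventually.of_forall fun x => by positivity)]
  have hpt : ∀ x, ENNReal.ofReal (|w x| ^ q) ≤ ENNReal.ofReal (|w x| ^ p) +
      ∑' k : ℕ, ({x | (2 : ℝ) ^ k < |w x|}).indicator
        (fun _ => ENNReal.ofReal (((2 : ℝ) ^ (k + 1)) ^ q)) x := by
    intro x
    rcases le_or_gt |w x| 1 with h1 | h1
    · refine le_add_of_le_of_nonneg (ENNReal.ofReal_le_ofReal ?_) zero_le
      rcases (abs_nonneg (w x)).eq_or_lt with h0 | h0
      · rw [← h0, Real.zero_rpow hq.ne', Real.zero_rpow hp.ne']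
      · exact Real.rpow_le_rpow_of_exponent_ge h0 h1 hpq
    -- Here `2^k < |w x| ≤ 2^(k+1)` for some `k`, and the `k`-th term of the sum suffices.
    · have hex : ∃ n : ℕ, |w x| ≤ 2 ^ n := by
        obtain ⟨n, hn⟩ := pow_unbounded_of_one_lt |w x| (by norm_num : (1 : ℝ) < 2)
        exact ⟨n, hn.le⟩
      classical
      obtain ⟨k, hk⟩ : ∃ k, Nat.find hex = k + 1 := Nat.exists_eq_succ_of_ne_zero fun h => by
        have := Nat.find_spec hex
        rw [h, pow_zero] at this
        linarith
      have hle : |w x| ≤ 2 ^ (k + 1) := hk ▸ Nat.find_spec hex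
      have hlt : (2 : ℝ) ^ k < |w x| := not_le.1 (Nat.find_min hex (by omega))
      refine le_add_of_nonneg_of_le zero_le (le_trans ?_ (ENNReal.le_tsum k))
      rw [indicator_of_mem (show x ∈ {x | (2 : ℝ) ^ k < |w x|} from hlt)]
      exact ENNReal.ofReal_le_ofReal (Real.rpow_le_rpow (abs_nonneg _) hle hq.le)
  refine (lintegral_mono hpt).trans_lt ?_
  rw [lintegral_add_left (by fun_prop), lintegral_tsum fun k =>
    (measurable_const.indicator (measurableSet_lt_abs hw _)).aemeasurable]
  refine ENNReal.add_lt_top.2 ⟨?_, ?_⟩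
  · exact (hasFiniteIntegral_iff_ofReal (Eventually.of_forall fun x => by positivity)).1 hL.2
  have hterm : ∀ k : ℕ, ∫⁻ x, ({x | (2 : ℝ) ^ k < |w x|}).indicator
      (fun _ => ENNReal.ofReal (((2 : ℝ) ^ (k + 1)) ^ q)) x ≤
      ENNReal.ofReal (2 ^ q * M * ((2 : ℝ) ^ (q - γ)) ^ k) := by
    intro k
    have h2k : (0 : ℝ) < 2 ^ k := by positivity
    rw [lintegral_indicator_const (measurableSet_lt_abs hw _),
      ← ENNReal.ofReal_toReal (measure_lt_abs_ne_top hp h2k hL),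
      ← ENNReal.ofReal_mul (by positivity)]
    refine ENNReal.ofReal_le_ofReal ((mul_le_mul_of_nonneg_left (hM k) (by positivity)).trans_eq ?_)
    have : ((2 : ℝ) ^ (q - γ)) ^ k = ((2 : ℝ) ^ k) ^ q * ((2 : ℝ) ^ k) ^ (-γ) := by
      rw [← Real.rpow_add h2k, ← Real.rpow_natCast, ← Real.rpow_natCast,
        ← Real.rpow_mul (by norm_num), ← Real.rpow_mul (by norm_num)]
      congr 1; ring
    rw [this, pow_succ, Real.mul_rpow h2k.le (by norm_num)]
    ring
  refine (ENNReal.tsum_le_tsum hterm).trans_lt ?_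
  refine (Summable.tsum_ofReal_ne_top ?_).lt_top
  exact (summable_geometric_of_lt_one (by positivity)
    (Real.rpow_lt_one_of_one_lt_of_neg (by norm_num) (by linarith))).mul_left _

/-- Subcritical Sobolev embedding of `W^{s,p}(ℝ^N)`, with `d = N + ps`: the critical exponent is
`p / (2 - d/N) = Np / (N - ps)`. -/
theorem integrable_abs_rpow_of_lt_critical (hN : 0 < N) {d p q : ℝ} (hp : 0 < p)
    (hd : (N : ℝ) < d) (hd2 : d < 2 * N) (hpq : p ≤ q) (hq : q < p / (2 - d / N))
    {w : Sp N → ℝ} (hw : Measurable w) (hL : Integrable fun x => |w x| ^ p)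
    (hE : Integrable (fun z => |incr w z| ^ p) (kernelMeasure N d)) :
    Integrable fun x => |w x| ^ q := by
  have hN' : (0 : ℝ) < N := by positivity
  obtain ⟨C, hC, hdecay⟩ := exists_measureReal_lt_abs_le hN hp hd hw hL hE
  have h1 : 1 < d / N := by rwa [one_lt_div hN']
  have h2 : d / N < 2 := by rwa [div_lt_iff₀ hN']
  obtain ⟨M, hM⟩ := exists_le_mul_rpow_of_recursion
    (a := fun k => (volume {x | (2 : ℝ) ^ k < |w x|}).toReal) (p := p) (θ := d / N - 1)
    (fun k => ENNReal.toReal_nonneg) hC (by linarith) (by linarith) (fun k => by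
      have := hdecay (2 ^ k) (by positivity)
      rwa [← pow_succ'] at this)
  refine integrable_abs_rpow_of_measure_le hp hpq ?_ hw hL hM
  rwa [show 1 - (d / N - 1) = 2 - d / N by ring]

/-! ### Measurable representatives -/

/-- A Carathéodory function of power growth on `Ω` agrees, for almost every `x ∈ Ω`, with a jointly
measurable function which is continuous in `t` and has the same growth for every `x`. -/
lemma exists_measurable_caratheodory {Ω : Set (Sp N)} {f : Sp N → ℝ → ℝ} {c r : ℝ}
    (hc : 0 ≤ c) (hf : IsCaratheodory Ω f)
    (hle : ∀ᵐ x ∂(volume.restrict Ω), ∀ t : ℝ, |f x t| ≤ c * (1 + |t| ^ r)) :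
    ∃ g : Sp N → ℝ → ℝ, Measurable (Function.uncurry g) ∧ (∀ x, Continuous (g x)) ∧
      (∀ x t, |g x t| ≤ c * (1 + |t| ^ r)) ∧ ∀ᵐ x ∂(volume.restrict Ω), g x = f x := by
  classical
  have hrat : ∀ᵐ x ∂(volume.restrict Ω), ∀ a : ℚ, f x a = (hf.1 a).mk _ x :=
    ae_all_iff.2 fun a => (hf.1 a).ae_eq_mk
  obtain ⟨S, hSae, hSm, hS⟩ := ((hf.2.and hle).and hrat).exists_measurable_mem
  -- Off the exceptional null set nothing is changed; on it the function is replaced by zero.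
  set g : Sp N → ℝ → ℝ := fun x t => S.indicator (fun x => f x t) x with hg
  have hgS : ∀ x ∈ S, g x = f x := fun x hx => by ext t; simp [hg, hx]
  have hgS' : ∀ x ∉ S, g x = fun _ => 0 := fun x hx => by ext t; simp [hg, hx]
  have hcont : ∀ x, Continuous (g x) := fun x => by
    by_cases hx : x ∈ S
    · rw [hgS x hx]; exact (hS x hx).1.1
    · rw [hgS' x hx]; exact continuous_const
  have hmrat : ∀ a : ℚ, Measurable fun x => g x a := fun a => by
    have : (fun x => g x a) = S.indicator ((hf.1 a).mk _) := by
      ext x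
      by_cases hx : x ∈ S
      · simp [hg, hx, (hS x hx).2 a]
      · simp [hg, hx]
    rw [this]
    exact (hf.1 a).measurable_mk.indicator hSm
  have hmeas : ∀ t : ℝ, Measurable fun x => g x t := fun t => by
    obtain ⟨a, ha, hat⟩ := mem_closure_iff_seq_limit.1 (Rat.denseRange_cast (𝕜 := ℝ) t)
    choose b hb using ha
    refine measurable_of_tendsto_metrizable (f := fun n x => g x (a n)) (fun n => ?_)
      (tendsto_pi_nhds.2 fun x => ((hcont x).tendsto t).comp hat)
    rw [← hb n]
    exact hmrat (b n)
  refine ⟨g, ?_, hcont, fun x t => ?_, ?_⟩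
  · have := measurable_uncurry_of_continuous_of_measurable (u := fun t x => g x t)
      (fun x => hcont x) hmeas
    exact this.comp measurable_swap
  · by_cases hx : x ∈ S
    · rw [hgS x hx]; exact (hS x hx).1.2 t
    · rw [hgS' x hx, abs_zero]; positivity
  · filter_upwards [hSae] with x hx using hgS x hx

/-- Measurable functions that lie in `W^{s,p}(U)`, `d = N + ps`, and whose `(p-1)`-th power is
integrable against `(1 + |x|)^{-d}`. -/
structure TailSob (p d : ℝ) (U : Set (Sp N)) (u : Sp N → ℝ) : Prop where
  meas : Measurable u
  lp : IntegrableOn (fun x => |u x| ^ p) U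
  energy : IntegrableOn (fun z => |incr u z| ^ p) (U ×ˢ U) (kernelMeasure N d)
  tail : Integrable fun x => |u x| ^ (p - 1) * (1 + ‖x‖) ^ (-d)

/-- Measurable functions in `W^{s,p}(ℝ^N)`, `d = N + ps`, that vanish at every point outside `Ω`:
the measurable representatives of the elements of `W₀^{s,p}(Ω)`. -/
structure ZeroSob (p d : ℝ) (Ω : Set (Sp N)) (v : Sp N → ℝ) : Prop where
  meas : Measurable v
  zero : ∀ x ∉ Ω, v x = 0
  lp : Integrable fun x => |v x| ^ p
  energy : Integrable (fun z => |incr v z| ^ p) (kernelMeasure N d)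

lemma TailSob.mono {p d : ℝ} {U V : Set (Sp N)} {u : Sp N → ℝ} (h : TailSob p d U u)
    (hVU : V ⊆ U) : TailSob p d V u :=
  ⟨h.meas, h.lp.mono_set hVU, h.energy.mono_set (prod_mono hVU hVU), h.tail⟩

section Closure

variable {p d : ℝ} {Ω : Set (Sp N)} {u v w : Sp N → ℝ}

/-- `W₀^{s,p}(Ω)` is closed under operations that are Lipschitz in two arguments. -/
lemma ZeroSob.of_le (hp : 0 < p) (hu : ZeroSob p d Ω u) (hv : ZeroSob p d Ω v)
    (hw : Measurable w) (hle : ∀ x, |w x| ≤ |u x| + |v x|)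
    (hincr : ∀ z, |incr w z| ≤ |incr u z| + |incr v z|) : ZeroSob p d Ω w where
  meas := hw
  zero x hx := by simpa [hu.zero x hx, hv.zero x hx] using hle x
  lp := by
    refine ((hu.lp.add hv.lp).const_mul (2 ^ p)).mono'
      (Measurable.aestronglyMeasurable (by fun_prop)) (Eventually.of_forall fun x => ?_)
    rw [Real.norm_of_nonneg (by positivity)]
    refine (Real.rpow_le_rpow (abs_nonneg _) ((hle x).trans (le_abs_self _)) hp.le).trans ?_
    simpa only [abs_abs, Pi.add_apply] using abs_add_rpow_le hp.le |u x| |v x|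
  energy := by
    refine ((hu.energy.add hv.energy).const_mul (2 ^ p)).mono'
      (Measurable.aestronglyMeasurable (by fun_prop)) (Eventually.of_forall fun z => ?_)
    rw [Real.norm_of_nonneg (by positivity)]
    refine (Real.rpow_le_rpow (abs_nonneg _) ((hincr z).trans (le_abs_self _)) hp.le).trans ?_
    simpa only [abs_abs, Pi.add_apply] using abs_add_rpow_le hp.le |incr u z| |incr v z|

lemma zeroSob_zero (hp : 0 < p) : ZeroSob p d Ω (fun _ => 0) where
  meas := measurable_const
  zero _ _ := rfl
  lp := by simp [Real.zero_rpow hp.ne']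
  energy := by simp [incr, Real.zero_rpow hp.ne']

lemma ZeroSob.const_mul (hu : ZeroSob p d Ω u) (t : ℝ) :
    ZeroSob p d Ω fun x => t * u x where
  meas := hu.meas.const_mul t
  zero x hx := by simp [hu.zero x hx]
  lp := by
    simpa only [abs_mul, Real.mul_rpow (abs_nonneg _) (abs_nonneg _)] using
      hu.lp.const_mul (|t| ^ p)
  energy := by
    have : ∀ z, incr (fun x => t * u x) z = t * incr u z := fun z => by simp only [incr]; ring
    simpa only [this, abs_mul, Real.mul_rpow (abs_nonneg _) (abs_nonneg _)] using
      hu.energy.const_mul (|t| ^ p)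

lemma ZeroSob.add (hp : 0 < p) (hu : ZeroSob p d Ω u) (hv : ZeroSob p d Ω v) :
    ZeroSob p d Ω fun x => u x + v x :=
  hu.of_le hp hv (hu.meas.add hv.meas) (fun x => abs_add_le _ _) fun z => by
    have : incr (fun x => u x + v x) z = incr u z + incr v z := by simp only [incr]; ring
    rw [this]; exact abs_add_le _ _

lemma ZeroSob.sub (hp : 0 < p) (hu : ZeroSob p d Ω u) (hv : ZeroSob p d Ω v) :
    ZeroSob p d Ω fun x => u x - v x :=
  hu.of_le hp hv (hu.meas.sub hv.meas) (fun x => abs_sub _ _) fun z => by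
    have : incr (fun x => u x - v x) z = incr u z - incr v z := by simp only [incr]; ring
    rw [this]; exact abs_sub _ _

lemma abs_incr_sup_le {X : Type*} (u v : X → ℝ) (z : X × X) :
    |incr (u ⊔ v) z| ≤ |incr u z| + |incr v z| :=
  (abs_max_sub_max_le_max _ _ _ _).trans
    (max_le_add_of_nonneg (abs_nonneg _) (abs_nonneg _))

lemma abs_incr_inf_le {X : Type*} (u v : X → ℝ) (z : X × X) :
    |incr (u ⊓ v) z| ≤ |incr u z| + |incr v z| :=
  (abs_min_sub_min_le_max _ _ _ _).trans
    (max_le_add_of_nonneg (abs_nonneg _) (abs_nonneg _))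

lemma abs_sup_le_abs_add_abs (a b : ℝ) : |a ⊔ b| ≤ |a| + |b| := by
  have := abs_nonneg a
  have := abs_nonneg b
  rcases max_choice a b with h | h <;> rw [h] <;> linarith

lemma abs_inf_le_abs_add_abs (a b : ℝ) : |a ⊓ b| ≤ |a| + |b| := by
  have := abs_nonneg a
  have := abs_nonneg b
  rcases min_choice a b with h | h <;> rw [h] <;> linarith

lemma ZeroSob.sup (hp : 0 < p) (hu : ZeroSob p d Ω u) (hv : ZeroSob p d Ω v) :
    ZeroSob p d Ω (u ⊔ v) :=
  hu.of_le hp hv (hu.meas.sup hv.meas) (fun _ => abs_sup_le_abs_add_abs _ _) (abs_incr_sup_le u v)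

lemma ZeroSob.inf (hp : 0 < p) (hu : ZeroSob p d Ω u) (hv : ZeroSob p d Ω v) :
    ZeroSob p d Ω (u ⊓ v) :=
  hu.of_le hp hv (hu.meas.inf hv.meas) (fun _ => abs_inf_le_abs_add_abs _ _) (abs_incr_inf_le u v)

end Closure

section Domain

variable {p d R δ : ℝ} {Ω U : Set (Sp N)} {u v w : Sp N → ℝ}

/-- Combining an element of `W₀^{s,p}(Ω)` with one of `W^{s,p}(U)` by a Lipschitz operation gives an
element of `W₀^{s,p}(Ω)`, provided that the result vanishes outside `Ω`. -/
lemma ZeroSob.of_le_tailSob (hp : 0 < p) (hd : (N : ℝ) < d) (hδ : 0 < δ)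
    (hU : MeasurableSet U) (hR : ∀ x ∈ Ω, ‖x‖ ≤ R) (hdist : ∀ x ∈ Ω, ∀ y ∉ U, δ ≤ ‖x - y‖)
    (hv : ZeroSob p d Ω v) (hu : TailSob p d U u) (hw : Measurable w) (hzero : ∀ x ∉ Ω, w x = 0)
    (hle : ∀ x, |w x| ≤ |v x| + |u x|) (hincr : ∀ z, |incr w z| ≤ |incr v z| + |incr u z|) :
    ZeroSob p d Ω w := by
  have h := integrable_incr_rpow_of_support hp hd hδ hU hR hdist hw hzero ?_ ?_
  · exact ⟨hw, hzero, h.1, h.2⟩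
  · refine ((hv.lp.integrableOn.add hu.lp).const_mul (2 ^ p)).mono'
      (Measurable.aestronglyMeasurable (by fun_prop)) (Eventually.of_forall fun x => ?_)
    rw [Real.norm_of_nonneg (by positivity)]
    refine (Real.rpow_le_rpow (abs_nonneg _) ((hle x).trans (le_abs_self _)) hp.le).trans ?_
    simpa only [abs_abs, Pi.add_apply] using abs_add_rpow_le hp.le |v x| |u x|
  · refine ((hv.energy.integrableOn.add hu.energy).const_mul (2 ^ p)).mono'
      (Measurable.aestronglyMeasurable (by fun_prop)) (Eventually.of_forall fun z => ?_)
    rw [Real.norm_of_nonneg (by positivity)]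
    refine (Real.rpow_le_rpow (abs_nonneg _) ((hincr z).trans (le_abs_self _)) hp.le).trans ?_
    simpa only [abs_abs, Pi.add_apply] using abs_add_rpow_le hp.le |incr v z| |incr u z|

lemma abs_oddPow_mul_le {p : ℝ} (hp : 2 ≤ p) (a b : ℝ) : |oddPow p a * b| ≤ |a| ^ p + |b| ^ p := by
  rw [abs_mul, abs_oddPow hp]
  exact rpow_sub_one_mul_le (by linarith) (abs_nonneg a) (abs_nonneg b)

lemma ZeroSob.integrable_pairing (hp : 2 ≤ p) (hu : ZeroSob p d Ω u) (hv : ZeroSob p d Ω v) :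
    Integrable (fun z => oddPow p (incr u z) * incr v z) (kernelMeasure N d) := by
  have hmu := measurable_incr hu.meas
  have hmv := measurable_incr hv.meas
  exact (hu.energy.add hv.energy).mono' (((continuous_oddPow hp).measurable.comp hmu).mul
    hmv).aestronglyMeasurable (Eventually.of_forall fun z => abs_oddPow_mul_le hp _ _)

/-- The pairing of `u ∈ W̃^{s,p}(Ω)` with `v ∈ W₀^{s,p}(Ω)` is absolutely convergent: on `U × U` by
Young's inequality, elsewhere because one of the two points lies in `Ω` and the other far from it,
where the weighted integrability of `|u|^{p-1}` takes over. -/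
lemma TailSob.integrable_pairing (hp : 2 ≤ p) (hd : (N : ℝ) < d) (hδ : 0 < δ)
    (hU : MeasurableSet U) (hR : ∀ x ∈ Ω, ‖x‖ ≤ R) (hdist : ∀ x ∈ Ω, ∀ y ∉ U, δ ≤ ‖x - y‖)
    (hΩ : volume Ω ≠ ∞) (hΩm : MeasurableSet Ω) (hu : TailSob p d U u) (hv : ZeroSob p d Ω v) :
    Integrable (fun z => oddPow p (incr u z) * incr v z) (kernelMeasure N d) := by
  have hmu := measurable_incr hu.meas
  have hmv := measurable_incr hv.meas
  have hmeas : Measurable fun z => oddPow p (incr u z) * incr v z :=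
    ((continuous_oddPow hp).measurable.comp hmu).mul hmv
  have hp1 : 0 ≤ p - 1 := by linarith
  have hΩU : ∀ x ∉ U, v x = 0 := fun x hx => hv.zero x fun h => by
    have := hdist x h x hx
    simp at this
    linarith
  have hnear : IntegrableOn (fun z => oddPow p (incr u z) * incr v z) (U ×ˢ U)
      (kernelMeasure N d) :=
    (hu.energy.add hv.energy.integrableOn).mono' hmeas.aestronglyMeasurable
      (Eventually.of_forall fun z => abs_oddPow_mul_le hp _ _)
  have hΩsub : Ω ⊆ U := fun x hx => by
    by_contra h
    have := hdist x hx x h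
    simp at this
    linarith
  have hA : Integrable fun x => 2 ^ (p - 1) * ((1 + |u x| ^ (p - 1)) * |v x|) := by
    -- `v` vanishes off `Ω`, so only the integrability of `u` on `Ω` matters here.
    refine Integrable.const_mul ?_ _
    have hΩint : IntegrableOn (fun x => 1 + |v x| ^ p + (|u x| ^ p + |v x| ^ p)) Ω :=
      ((integrableOn_const hΩ).add hv.lp.integrableOn).add
        ((hu.lp.mono_set hΩsub).add hv.lp.integrableOn)
    have hum := hu.meas
    have hvm := hv.meas
    refine ((integrable_indicator_iff hΩm).2 hΩint).mono'
      (Measurable.aestronglyMeasurable (by fun_prop)) (Eventually.of_forall fun x => ?_)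
    rw [Real.norm_of_nonneg (by positivity)]
    by_cases hx : x ∈ Ω
    · rw [indicator_of_mem hx]
      have h1 := rpow_sub_one_mul_le (by linarith : 1 ≤ p) zero_le_one (abs_nonneg (v x))
      have h2 := rpow_sub_one_mul_le (by linarith : 1 ≤ p) (abs_nonneg (u x)) (abs_nonneg (v x))
      simp only [Real.one_rpow, one_mul] at h1
      linarith
    · rw [indicator_of_notMem hx, hv.zero x hx, abs_zero, mul_zero]
  have hB : Integrable fun x => (1 + |u x| ^ (p - 1)) * (1 + ‖x‖) ^ (-d) := by
    simp only [add_mul, one_mul]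
    exact (integrable_one_add_norm_rpow hd).add hu.tail
  have hfar : ∀ x y : Sp N, v y = 0 → |oddPow p (u x - u y) * (v x - v y)| ≤
      2 ^ (p - 1) * ((1 + |u x| ^ (p - 1)) * |v x|) * (1 + |u y| ^ (p - 1)) := by
    intro x y hy
    rw [hy, sub_zero, abs_mul, abs_oddPow hp]
    have h1 := abs_add_rpow_le hp1 (u x) (-u y)
    rw [abs_neg, ← sub_eq_add_neg] at h1
    have h2 : |u x| ^ (p - 1) + |u y| ^ (p - 1) ≤
        (1 + |u x| ^ (p - 1)) * (1 + |u y| ^ (p - 1)) := by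
      have : 0 ≤ |u x| ^ (p - 1) * |u y| ^ (p - 1) := by positivity
      linarith
    calc |u x - u y| ^ (p - 1) * |v x|
        ≤ 2 ^ (p - 1) * ((1 + |u x| ^ (p - 1)) * (1 + |u y| ^ (p - 1))) * |v x| :=
          mul_le_mul_of_nonneg_right
            (h1.trans (mul_le_mul_of_nonneg_left h2 (by positivity))) (abs_nonneg _)
      _ = _ := by ring
  refine integrable_kernelMeasure_of_le_off (le_trans (by positivity) hd.le) hδ hU hR hdist hmeas
    hnear (A := fun x => 2 ^ (p - 1) * ((1 + |u x| ^ (p - 1)) * |v x|))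
    (B := fun x => 1 + |u x| ^ (p - 1)) (fun x => by positivity) (fun x => by positivity)
    (fun x hx => by simp [hv.zero x hx]) hA hB fun z hz => ?_
  have h1 : 0 ≤ 2 ^ (p - 1) * ((1 + |u z.1| ^ (p - 1)) * |v z.1|) * (1 + |u z.2| ^ (p - 1)) := by
    positivity
  have h2 : 0 ≤ 2 ^ (p - 1) * ((1 + |u z.2| ^ (p - 1)) * |v z.2|) * (1 + |u z.1| ^ (p - 1)) := by
    positivity
  by_cases h : z.2 ∈ U
  · have h' : z.1 ∉ U := fun h' => hz ⟨h', h⟩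
    have e : oddPow p (incr u z) * incr v z = oddPow p (u z.2 - u z.1) * (v z.2 - v z.1) := by
      rw [incr, incr, ← neg_sub (u z.2), ← neg_sub (v z.2), oddPow_neg, neg_mul_neg]
    rw [e]
    linarith [hfar z.2 z.1 (hΩU _ h')]
  · have := hfar z.1 z.2 (hΩU _ h)
    simp only [incr]
    linarith

/-- A function of `W^{s,p}` near the closure of `Ω` has subcritical integrability on `Ω`: multiply
by a Lipschitz cutoff equal to `1` on `Ω` and supported halfway to the complement of `U`. -/
lemma TailSob.integrableOn_abs_rpow (hN : 0 < N) {q : ℝ} (hp : 0 < p) (hd : (N : ℝ) < d)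
    (hdp : d < N + p) (hd2 : d < 2 * N) (hpq : p ≤ q) (hq : q < p / (2 - d / N)) (hδ : 0 < δ)
    (hU : MeasurableSet U) (hne : Ω.Nonempty) (hΩm : MeasurableSet Ω) (hR : ∀ x ∈ Ω, ‖x‖ ≤ R)
    (hdist : ∀ x ∈ Ω, ∀ y ∉ U, δ ≤ ‖x - y‖) (hu : TailSob p d U u) :
    IntegrableOn (fun x => |u x| ^ q) Ω := by
  set η : Sp N → ℝ := fun x => max 0 (1 - 2 / δ * Metric.infDist x Ω) with hη
  have hη0 : ∀ x, 0 ≤ η x := fun x => le_max_left _ _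
  have hη1 : ∀ x, η x ≤ 1 := fun x => max_le zero_le_one
    (sub_le_self _ (mul_nonneg (by positivity) Metric.infDist_nonneg))
  have hηL : ∀ x y, |η x - η y| ≤ 2 / δ * ‖x - y‖ := fun x y => by
    have h1 := abs_max_sub_max_le_max 0 (1 - 2 / δ * Metric.infDist x Ω) 0
      (1 - 2 / δ * Metric.infDist y Ω)
    have h2 := (Metric.lipschitz_infDist_pt Ω).dist_le_mul y x
    simp only [NNReal.coe_one, one_mul, Real.dist_eq] at h2
    rw [dist_comm, dist_eq_norm] at h2
    have h3 : 1 - 2 / δ * Metric.infDist x Ω - (1 - 2 / δ * Metric.infDist y Ω) =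
      2 / δ * (Metric.infDist y Ω - Metric.infDist x Ω) := by ring
    rw [h3, sub_self, abs_zero] at h1
    refine h1.trans (max_le (by positivity) ?_)
    rw [abs_mul, abs_of_nonneg (by positivity : 0 ≤ 2 / δ)]
    exact mul_le_mul_of_nonneg_left h2 (by positivity)
  have hηm : Measurable η := by
    have : Continuous fun x : Sp N => Metric.infDist x Ω := Metric.continuous_infDist_pt Ω
    have : Continuous η := by fun_prop
    exact this.measurable
  have hηΩ : ∀ x ∈ Ω, η x = 1 := fun x hx => by
    simp [hη, Metric.infDist_zero_of_mem hx]
  set w : Sp N → ℝ := fun x => η x * u x with hw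
  have hwm : Measurable w := hηm.mul hu.meas
  set Ω' : Set (Sp N) := {x | Metric.infDist x Ω < δ / 2} with hΩ'
  have hwzero : ∀ x ∉ Ω', w x = 0 := fun x hx => by
    have h1 : δ / 2 ≤ Metric.infDist x Ω := not_lt.1 hx
    have h2 : 1 ≤ 2 / δ * Metric.infDist x Ω := by
      rw [div_mul_eq_mul_div, le_div_iff₀ hδ]; linarith
    simp only [hw, hη]
    rw [max_eq_left (by linarith), zero_mul]
  have hclose : ∀ x ∈ Ω', ∃ y ∈ Ω, ‖x - y‖ < δ / 2 := fun x hx => by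
    obtain ⟨y, hy, hxy⟩ := (Metric.infDist_lt_iff hne).1 hx
    exact ⟨y, hy, by rwa [← dist_eq_norm]⟩
  have hR' : ∀ x ∈ Ω', ‖x‖ ≤ R + δ := fun x hx => by
    obtain ⟨y, hy, hxy⟩ := hclose x hx
    have h1 := norm_sub_norm_le x y
    have h2 := hR y hy
    linarith
  have hdist' : ∀ x ∈ Ω', ∀ y ∉ U, δ / 2 ≤ ‖x - y‖ := fun x hx y hy => by
    obtain ⟨x', hx', hxx⟩ := hclose x hx
    have h1 := hdist x' hx' y hy
    have h2 := norm_sub_le_norm_sub_add_norm_sub x' x y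
    rw [norm_sub_rev] at hxx
    linarith
  have hwL : IntegrableOn (fun x => |w x| ^ p) U := by
    refine hu.lp.mono' (Measurable.aestronglyMeasurable (by fun_prop))
      (Eventually.of_forall fun x => ?_)
    rw [Real.norm_of_nonneg (by positivity)]
    refine Real.rpow_le_rpow (abs_nonneg _) ?_ hp.le
    rw [hw, abs_mul, abs_of_nonneg (hη0 x)]
    exact mul_le_of_le_one_left (abs_nonneg _) (hη1 x)
  have hwE := integrableOn_incr_mul_rpow hN hp hd hdp (by positivity) hU hu.meas hηm hη0 hη1 hηL
    hu.lp hu.energy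
  obtain ⟨h1, h2⟩ := integrable_incr_rpow_of_support hp hd (by positivity) hU hR' hdist' hwm
    hwzero hwL hwE
  have h3 := integrable_abs_rpow_of_lt_critical hN hp hd hd2 hpq hq hwm h1 h2
  refine (integrableOn_congr_fun (fun x hx => ?_) hΩm).1 h3.integrableOn
  simp [hw, hηΩ x hx]

end Domain

/-! ### The truncated functional -/

/-- An ordered pair of barriers `u₁ ≤ u₂`, subsolution and supersolution of the problem with
reaction `g`, in the form in which the variational argument uses them: functions are measurable and
inequalities hold at every point, `Ω` is bounded and at distance at least `δ` from the complement of
`U`, and the functions involved are in `L^q(Ω)`. Here `d = N + ps`. -/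
structure Barriers (p q d c R δ : ℝ) (Ω U : Set (Sp N)) (g : Sp N → ℝ → ℝ) (u₁ u₂ : Sp N → ℝ) :
    Prop where
  two_le : 2 ≤ p
  le_q : p ≤ q
  lt_d : (N : ℝ) < d
  c_nonneg : 0 ≤ c
  δ_pos : 0 < δ
  measΩ : MeasurableSet Ω
  measU : MeasurableSet U
  norm_le : ∀ x ∈ Ω, ‖x‖ ≤ R
  dist_le : ∀ x ∈ Ω, ∀ y ∉ U, δ ≤ ‖x - y‖
  meas_g : Measurable (Function.uncurry g)
  cont_g : ∀ x, Continuous (g x)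
  growth : ∀ x t, |g x t| ≤ c * (1 + |t| ^ (q - 1))
  tail₁ : TailSob p d U u₁
  tail₂ : TailSob p d U u₂
  le : ∀ x, u₁ x ≤ u₂ x
  nonpos₁ : ∀ x ∉ Ω, u₁ x ≤ 0
  nonneg₂ : ∀ x ∉ Ω, 0 ≤ u₂ x
  embed : ∀ v, ZeroSob p d Ω v → Integrable fun x => |v x| ^ q
  lq₁ : IntegrableOn (fun x => |u₁ x| ^ q) Ω
  lq₂ : IntegrableOn (fun x => |u₂ x| ^ q) Ω
  sub : ∀ v, ZeroSob p d Ω v → (∀ x, 0 ≤ v x) →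
    ∫ z, oddPow p (incr u₁ z) * incr v z ∂(kernelMeasure N d) ≤ ∫ x in Ω, g x (u₁ x) * v x
  super : ∀ v, ZeroSob p d Ω v → (∀ x, 0 ≤ v x) →
    ∫ x in Ω, g x (u₂ x) * v x ≤ ∫ z, oddPow p (incr u₂ z) * incr v z ∂(kernelMeasure N d)

/-- The reaction frozen outside the order interval: `g(x, t)` with `t` clamped to
`[u₁ x, u₂ x]`. -/
def truncated (g : Sp N → ℝ → ℝ) (u₁ u₂ : Sp N → ℝ) (x : Sp N) (t : ℝ) : ℝ :=
  g x (u₁ x ⊔ (t ⊓ u₂ x))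

/-- The primitive of the truncated reaction that vanishes at `t = 0`. -/
noncomputable def primitive (g : Sp N → ℝ → ℝ) (u₁ u₂ : Sp N → ℝ) (x : Sp N) (t : ℝ) : ℝ :=
  ∫ τ in (0 : ℝ)..t, truncated g u₁ u₂ x τ

/-- The `p`-th power of the Gagliardo seminorm as a real number. -/
noncomputable def energy (p d : ℝ) (w : Sp N → ℝ) : ℝ :=
  ∫ z, |incr w z| ^ p ∂(kernelMeasure N d)

/-- The functional whose critical points solve the truncated problem. -/
noncomputable def functional (p d : ℝ) (Ω : Set (Sp N)) (g : Sp N → ℝ → ℝ) (u₁ u₂ : Sp N → ℝ)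
    (w : Sp N → ℝ) : ℝ :=
  energy p d w / p - ∫ x in Ω, primitive g u₁ u₂ x (w x)

lemma energy_nonneg (p d : ℝ) (w : Sp N → ℝ) : 0 ≤ energy p d w :=
  integral_nonneg fun _ => by positivity

/-- The integrated tangent inequality for the energy. -/
lemma energy_add_le {p d : ℝ} {Ω : Set (Sp N)} {m w : Sp N → ℝ} (hp : 2 ≤ p)
    (hm : ZeroSob p d Ω m) (hw : ZeroSob p d Ω w) :
    energy p d m + p * ∫ z, oddPow p (incr m z) * (incr w z - incr m z) ∂(kernelMeasure N d) ≤
      energy p d w := by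
  have h1 : Integrable (fun z => oddPow p (incr m z) * (incr w z - incr m z))
      (kernelMeasure N d) := by
    simp only [mul_sub]
    exact (hm.integrable_pairing hp hw).sub (hm.integrable_pairing hp hm)
  rw [energy, energy, ← integral_const_mul, ← integral_add hm.energy (h1.const_mul p)]
  exact integral_mono (hm.energy.add (h1.const_mul p)) hw.energy fun z =>
    abs_rpow_add_oddPow_mul_sub_le hp _ _

lemma energy_sup_add_energy_inf_le {p d : ℝ} {Ω : Set (Sp N)} {v w : Sp N → ℝ} (hp : 2 ≤ p)
    (hv : ZeroSob p d Ω v) (hw : ZeroSob p d Ω w) :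
    energy p d (v ⊔ w) + energy p d (v ⊓ w) ≤ energy p d v + energy p d w := by
  have hp0 : 0 < p := by linarith
  have hs := (hv.sup hp0 hw).energy
  have hi := (hv.inf hp0 hw).energy
  rw [energy, energy, energy, energy, ← integral_add hs hi, ← integral_add hv.energy hw.energy]
  exact integral_mono (hs.add hi) (hv.energy.add hw.energy) fun z =>
    abs_sup_sub_rpow_add_abs_inf_sub_rpow_le (by linarith) _ _ _ _

namespace Barriers

variable {p q d c R δ : ℝ} {Ω U : Set (Sp N)} {g : Sp N → ℝ → ℝ} {u₁ u₂ : Sp N → ℝ}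

lemma p_pos (B : Barriers p q d c R δ Ω U g u₁ u₂) : 0 < p := by linarith [B.two_le]

lemma measure_ne_top (B : Barriers p q d c R δ Ω U g u₁ u₂) : volume Ω ≠ ∞ :=
  ((measure_mono fun x hx => mem_closedBall_zero_iff.2 (B.norm_le x hx)).trans_lt
    (measure_closedBall_lt_top (x := (0 : Sp N)) (r := R))).ne

lemma continuous_truncated (B : Barriers p q d c R δ Ω U g u₁ u₂) (x : Sp N) :
    Continuous (truncated g u₁ u₂ x) :=
  (B.cont_g x).comp (continuous_const.sup (continuous_id.inf continuous_const))

lemma measurable_uncurry_truncated (B : Barriers p q d c R δ Ω U g u₁ u₂) :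
    Measurable (Function.uncurry (truncated g u₁ u₂)) := by
  have h : Measurable fun z : Sp N × ℝ => (z.1, u₁ z.1 ⊔ (z.2 ⊓ u₂ z.1)) :=
    measurable_fst.prodMk ((B.tail₁.meas.comp measurable_fst).sup
      (measurable_snd.inf (B.tail₂.meas.comp measurable_fst)))
  exact B.meas_g.comp h

lemma truncated_of_mem (x : Sp N) {t : ℝ} (h₁ : u₁ x ≤ t) (h₂ : t ≤ u₂ x) :
    truncated g u₁ u₂ x t = g x t := by
  rw [truncated, inf_of_le_left h₂, sup_of_le_right h₁]

lemma truncated_of_ge (B : Barriers p q d c R δ Ω U g u₁ u₂) (x : Sp N) {t : ℝ} (h : u₂ x ≤ t) :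
    truncated g u₁ u₂ x t = g x (u₂ x) := by
  rw [truncated, inf_of_le_right h, sup_of_le_right (B.le x)]

lemma truncated_of_le (x : Sp N) {t : ℝ} (h : t ≤ u₁ x) :
    truncated g u₁ u₂ x t = g x (u₁ x) := by
  rw [truncated, sup_of_le_left (inf_le_left.trans h)]

lemma abs_truncated_le (B : Barriers p q d c R δ Ω U g u₁ u₂) (x : Sp N) (t : ℝ) :
    |truncated g u₁ u₂ x t| ≤ c * (1 + (|u₁ x| + |u₂ x|) ^ (q - 1)) := by
  have hq := B.le_q
  have hp := B.two_le
  refine (B.growth x _).trans (mul_le_mul_of_nonneg_left ?_ B.c_nonneg)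
  have h1 : u₁ x ≤ u₁ x ⊔ (t ⊓ u₂ x) := le_sup_left
  have h2 : u₁ x ⊔ (t ⊓ u₂ x) ≤ u₂ x := sup_le (B.le x) inf_le_right
  have h3 : |u₁ x ⊔ (t ⊓ u₂ x)| ≤ |u₁ x| + |u₂ x| := by
    rw [abs_le]
    constructor
    · linarith [neg_abs_le (u₁ x), abs_nonneg (u₂ x)]
    · linarith [le_abs_self (u₂ x), abs_nonneg (u₁ x)]
  linarith [Real.rpow_le_rpow (abs_nonneg _) h3 (by linarith : 0 ≤ q - 1)]

/-- The growth bound of the truncated reaction pairs with `L^q(Ω)`. -/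
lemma integrableOn_bound_mul (B : Barriers p q d c R δ Ω U g u₁ u₂) {v : Sp N → ℝ}
    (hv : Measurable v) (hvq : IntegrableOn (fun x => |v x| ^ q) Ω) :
    IntegrableOn (fun x => c * (1 + (|u₁ x| + |u₂ x|) ^ (q - 1)) * |v x|) Ω := by
  have hq : 1 ≤ q := by linarith [B.le_q, B.two_le]
  have h1 := B.tail₁.meas
  have h2 := B.tail₂.meas
  have hc := B.c_nonneg
  have hmaj : IntegrableOn (fun x => c * ((1 + |v x| ^ q) +
      (2 ^ q * (|u₁ x| ^ q + |u₂ x| ^ q) + |v x| ^ q))) Ω :=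
    Integrable.const_mul (((integrableOn_const B.measure_ne_top).add hvq).add
      (((B.lq₁.add B.lq₂).const_mul _).add hvq)) c
  refine hmaj.mono' (Measurable.aestronglyMeasurable (by fun_prop))
    (Eventually.of_forall fun x => ?_)
  rw [Real.norm_of_nonneg (by positivity), mul_assoc]
  refine mul_le_mul_of_nonneg_left ?_ hc
  rw [add_mul]
  have e1 := rpow_sub_one_mul_le hq zero_le_one (abs_nonneg (v x))
  have e2 := rpow_sub_one_mul_le hq (by positivity : 0 ≤ |u₁ x| + |u₂ x|) (abs_nonneg (v x))
  have e3 := abs_add_rpow_le (by linarith : 0 ≤ q) |u₁ x| |u₂ x|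
  rw [abs_of_nonneg (by positivity : 0 ≤ |u₁ x| + |u₂ x|), abs_abs, abs_abs] at e3
  simp only [Real.one_rpow] at e1
  linarith

lemma primitive_sub (B : Barriers p q d c R δ Ω U g u₁ u₂) (x : Sp N) (a b : ℝ) :
    primitive g u₁ u₂ x b - primitive g u₁ u₂ x a = ∫ τ in a..b, truncated g u₁ u₂ x τ :=
  intervalIntegral.integral_interval_sub_left
    ((B.continuous_truncated x).intervalIntegrable _ _)
    ((B.continuous_truncated x).intervalIntegrable _ _)

lemma abs_primitive_sub_le (B : Barriers p q d c R δ Ω U g u₁ u₂) (x : Sp N) (a b : ℝ) :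
    |primitive g u₁ u₂ x b - primitive g u₁ u₂ x a| ≤
      c * (1 + (|u₁ x| + |u₂ x|) ^ (q - 1)) * |b - a| := by
  rw [B.primitive_sub, ← Real.norm_eq_abs]
  exact intervalIntegral.norm_integral_le_of_norm_le_const fun t _ => B.abs_truncated_le x t

lemma abs_primitive_le (B : Barriers p q d c R δ Ω U g u₁ u₂) (x : Sp N) (a : ℝ) :
    |primitive g u₁ u₂ x a| ≤ c * (1 + (|u₁ x| + |u₂ x|) ^ (q - 1)) * |a| := by
  simpa [primitive] using B.abs_primitive_sub_le x 0 a

lemma hasDerivAt_primitive (B : Barriers p q d c R δ Ω U g u₁ u₂) (x : Sp N) (t : ℝ) :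
    HasDerivAt (primitive g u₁ u₂ x) (truncated g u₁ u₂ x t) t :=
  ((B.continuous_truncated x).integral_hasStrictDerivAt 0 t).hasDerivAt

lemma primitive_sub_primitive_inf (B : Barriers p q d c R δ Ω U g u₁ u₂) (x : Sp N) (t : ℝ) :
    primitive g u₁ u₂ x t - primitive g u₁ u₂ x (t ⊓ u₂ x) =
      g x (u₂ x) * (t - t ⊓ u₂ x) := by
  rcases le_total t (u₂ x) with h | h
  · simp [inf_of_le_left h]
  · rw [inf_of_le_right h, B.primitive_sub, intervalIntegral.integral_congr
      (g := fun _ => g x (u₂ x)), intervalIntegral.integral_const, smul_eq_mul, mul_comm]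
    intro τ hτ
    rw [uIcc_of_le h] at hτ
    exact B.truncated_of_ge x hτ.1

lemma primitive_sup_sub_primitive (B : Barriers p q d c R δ Ω U g u₁ u₂) (x : Sp N) (t : ℝ) :
    primitive g u₁ u₂ x (t ⊔ u₁ x) - primitive g u₁ u₂ x t =
      g x (u₁ x) * (t ⊔ u₁ x - t) := by
  rcases le_total (u₁ x) t with h | h
  · simp [sup_of_le_left h]
  · rw [sup_of_le_right h, B.primitive_sub, intervalIntegral.integral_congr
      (g := fun _ => g x (u₁ x)), intervalIntegral.integral_const, smul_eq_mul, mul_comm]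
    intro τ hτ
    rw [uIcc_of_le h] at hτ
    exact truncated_of_le x hτ.2

lemma measurable_primitive (B : Barriers p q d c R δ Ω U g u₁ u₂) {w : Sp N → ℝ}
    (hw : Measurable w) : Measurable fun x => primitive g u₁ u₂ x (w x) := by
  -- Rescaled to a fixed interval, the integral depends measurably on the parameter by Fubini.
  have e : (fun x => primitive g u₁ u₂ x (w x)) =
      fun x => w x * ∫ τ in (0 : ℝ)..1, truncated g u₁ u₂ x (τ * w x) := by
    ext x
    rw [intervalIntegral.mul_integral_comp_mul_right, zero_mul, one_mul, primitive]
  rw [e]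
  refine hw.mul ?_
  simp only [intervalIntegral.integral_of_le zero_le_one]
  have h : Measurable (Function.uncurry fun x τ => truncated g u₁ u₂ x (τ * w x)) :=
    B.measurable_uncurry_truncated.comp
      (measurable_fst.prodMk (measurable_snd.mul (hw.comp measurable_fst)))
  exact h.stronglyMeasurable.integral_prod_right.measurable

lemma integrableOn_primitive (B : Barriers p q d c R δ Ω U g u₁ u₂) {w : Sp N → ℝ}
    (hw : Measurable w) (hwq : IntegrableOn (fun x => |w x| ^ q) Ω) :
    IntegrableOn (fun x => primitive g u₁ u₂ x (w x)) Ω :=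
  (B.integrableOn_bound_mul hw hwq).mono' (B.measurable_primitive hw).aestronglyMeasurable
    (Eventually.of_forall fun x => B.abs_primitive_le x (w x))

lemma integrableOn_primitive_of_zeroSob (B : Barriers p q d c R δ Ω U g u₁ u₂) {w : Sp N → ℝ}
    (hw : ZeroSob p d Ω w) : IntegrableOn (fun x => primitive g u₁ u₂ x (w x)) Ω :=
  B.integrableOn_primitive hw.meas (B.embed w hw).integrableOn

lemma zeroSob_inf (B : Barriers p q d c R δ Ω U g u₁ u₂) {w : Sp N → ℝ}
    (hw : ZeroSob p d Ω w) : ZeroSob p d Ω (w ⊓ u₂) :=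
  hw.of_le_tailSob B.p_pos B.lt_d B.δ_pos B.measU B.norm_le B.dist_le B.tail₂
    (hw.meas.inf B.tail₂.meas)
    (fun x hx => by simpa [hw.zero x hx] using B.nonneg₂ x hx)
    (fun _ => abs_inf_le_abs_add_abs _ _) (abs_incr_inf_le _ _)

lemma zeroSob_sup (B : Barriers p q d c R δ Ω U g u₁ u₂) {w : Sp N → ℝ}
    (hw : ZeroSob p d Ω w) : ZeroSob p d Ω (w ⊔ u₁) :=
  hw.of_le_tailSob B.p_pos B.lt_d B.δ_pos B.measU B.norm_le B.dist_le B.tail₁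
    (hw.meas.sup B.tail₁.meas)
    (fun x hx => by simpa [hw.zero x hx] using B.nonpos₁ x hx)
    (fun _ => abs_sup_le_abs_add_abs _ _) (abs_incr_sup_le _ _)

/-! ### Minimization in the order interval -/

/-- Cutting a competitor at the supersolution does not increase the functional: the truncated
reaction is constant above `u₂`, and the excess `w - w ⊓ u₂` is an admissible test function. -/
lemma functional_inf_le (B : Barriers p q d c R δ Ω U g u₁ u₂) {w : Sp N → ℝ}
    (hw : ZeroSob p d Ω w) :
    functional p d Ω g u₁ u₂ (w ⊓ u₂) ≤ functional p d Ω g u₁ u₂ w := by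
  have hp := B.p_pos
  have hm := B.zeroSob_inf hw
  have hψ := hw.sub hp hm
  have hψ0 : ∀ x, 0 ≤ w x - (w ⊓ u₂) x := fun x => sub_nonneg.2 inf_le_left
  have e : ∀ z, incr w z - incr (w ⊓ u₂) z = incr (fun x => w x - (w ⊓ u₂) x) z := fun z => by
    simp only [incr]; ring
  have h1 := energy_add_le B.two_le hm hw
  simp only [e] at h1
  have h2 : ∫ z, oddPow p (incr u₂ z) * incr (fun x => w x - (w ⊓ u₂) x) z ∂(kernelMeasure N d) ≤
      ∫ z, oddPow p (incr (w ⊓ u₂) z) * incr (fun x => w x - (w ⊓ u₂) x) z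
        ∂(kernelMeasure N d) :=
    integral_mono (B.tail₂.integrable_pairing B.two_le B.lt_d B.δ_pos B.measU B.norm_le B.dist_le
      B.measure_ne_top B.measΩ hψ) (hm.integrable_pairing B.two_le hψ) fun z =>
        oddPow_mul_excess_le B.two_le _ _ _ _
  have h3 := B.super _ hψ hψ0
  have h4 : (∫ x in Ω, primitive g u₁ u₂ x (w x)) -
      ∫ x in Ω, primitive g u₁ u₂ x ((w ⊓ u₂) x) =
        ∫ x in Ω, g x (u₂ x) * (w x - (w ⊓ u₂) x) := by
    rw [← integral_sub (B.integrableOn_primitive_of_zeroSob hw)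
      (B.integrableOn_primitive_of_zeroSob hm)]
    exact integral_congr_ae (Eventually.of_forall fun x => B.primitive_sub_primitive_inf x (w x))
  have h5 := mul_le_mul_of_nonneg_left (h3.trans h2) hp.le
  rw [← h4] at h5
  have h6 : energy p d (w ⊓ u₂) / p + ((∫ x in Ω, primitive g u₁ u₂ x (w x)) -
      ∫ x in Ω, primitive g u₁ u₂ x ((w ⊓ u₂) x)) ≤ energy p d w / p := by
    rw [div_add' _ _ _ hp.ne', div_le_div_iff_of_pos_right hp]
    linarith
  simp only [functional]
  linarith

/-- Raising a competitor to the subsolution does not increase the functional, for the same reason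
as in `functional_inf_le`. -/
lemma functional_sup_le (B : Barriers p q d c R δ Ω U g u₁ u₂) {w : Sp N → ℝ}
    (hw : ZeroSob p d Ω w) :
    functional p d Ω g u₁ u₂ (w ⊔ u₁) ≤ functional p d Ω g u₁ u₂ w := by
  have hp := B.p_pos
  have hm := B.zeroSob_sup hw
  have hψ := hm.sub hp hw
  have hψ0 : ∀ x, 0 ≤ (w ⊔ u₁) x - w x := fun x => sub_nonneg.2 le_sup_left
  have e : ∀ z, oddPow p (incr (w ⊔ u₁) z) * (incr w z - incr (w ⊔ u₁) z) =
      -(oddPow p (incr (w ⊔ u₁) z) * incr (fun x => (w ⊔ u₁) x - w x) z) := fun z => by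
    simp only [incr]; ring
  have h1 := energy_add_le B.two_le hm hw
  simp only [e, integral_neg] at h1
  have h2 : ∫ z, oddPow p (incr (w ⊔ u₁) z) * incr (fun x => (w ⊔ u₁) x - w x) z
        ∂(kernelMeasure N d) ≤
      ∫ z, oddPow p (incr u₁ z) * incr (fun x => (w ⊔ u₁) x - w x) z ∂(kernelMeasure N d) :=
    integral_mono (hm.integrable_pairing B.two_le hψ) (B.tail₁.integrable_pairing B.two_le B.lt_d
      B.δ_pos B.measU B.norm_le B.dist_le B.measure_ne_top B.measΩ hψ) fun z =>
        oddPow_mul_deficit_le B.two_le _ _ _ _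
  have h3 := B.sub _ hψ hψ0
  have h4 : (∫ x in Ω, primitive g u₁ u₂ x ((w ⊔ u₁) x)) -
      ∫ x in Ω, primitive g u₁ u₂ x (w x) =
        ∫ x in Ω, g x (u₁ x) * ((w ⊔ u₁) x - w x) := by
    rw [← integral_sub (B.integrableOn_primitive_of_zeroSob hm)
      (B.integrableOn_primitive_of_zeroSob hw)]
    exact integral_congr_ae (Eventually.of_forall fun x => B.primitive_sup_sub_primitive x (w x))
  have h5 := mul_le_mul_of_nonneg_left (h2.trans h3) hp.le
  rw [← h4] at h5
  have h6 : energy p d (w ⊔ u₁) / p ≤ energy p d w / p +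
      ((∫ x in Ω, primitive g u₁ u₂ x ((w ⊔ u₁) x)) - ∫ x in Ω, primitive g u₁ u₂ x (w x)) := by
    rw [div_add' _ _ _ hp.ne', div_le_div_iff_of_pos_right hp]
    linarith
  simp only [functional]
  linarith

lemma abs_le_of_mem {w : Sp N → ℝ} {x : Sp N} (h₁ : u₁ x ≤ w x) (h₂ : w x ≤ u₂ x) :
    |w x| ≤ |u₁ x| + |u₂ x| := by
  rw [abs_le]
  constructor
  · linarith [neg_abs_le (u₁ x), abs_nonneg (u₂ x)]
  · linarith [le_abs_self (u₂ x), abs_nonneg (u₁ x)]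

/-- The bound `|u₁| + |u₂|` for functions in the order interval, paired with the growth bound of
the truncated reaction. -/
lemma integrableOn_bound_mul_barriers (B : Barriers p q d c R δ Ω U g u₁ u₂) :
    IntegrableOn (fun x => c * (1 + (|u₁ x| + |u₂ x|) ^ (q - 1)) * (|u₁ x| + |u₂ x|)) Ω := by
  simp only [mul_add _ |u₁ _| |u₂ _|]
  exact (B.integrableOn_bound_mul B.tail₁.meas B.lq₁).add
    (B.integrableOn_bound_mul B.tail₂.meas B.lq₂)

lemma abs_primitive_le_of_mem (B : Barriers p q d c R δ Ω U g u₁ u₂) {w : Sp N → ℝ} {x : Sp N}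
    (h₁ : u₁ x ≤ w x) (h₂ : w x ≤ u₂ x) : |primitive g u₁ u₂ x (w x)| ≤
      c * (1 + (|u₁ x| + |u₂ x|) ^ (q - 1)) * (|u₁ x| + |u₂ x|) :=
  (B.abs_primitive_le x (w x)).trans (mul_le_mul_of_nonneg_left (abs_le_of_mem h₁ h₂)
    (mul_nonneg B.c_nonneg (by positivity)))

/-- Sublevel sets of the functional in the order interval are closed under pointwise limits: Fatou's
lemma for the energy, dominated convergence for the reaction term. -/
lemma functional_le_of_tendsto (B : Barriers p q d c R δ Ω U g u₁ u₂) {w : ℕ → Sp N → ℝ}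
    {v : Sp N → ℝ} {C : ℝ} (hw : ∀ n, ZeroSob p d Ω (w n)) (h₁ : ∀ n, u₁ ≤ w n)
    (h₂ : ∀ n, w n ≤ u₂) (hC : ∀ n, functional p d Ω g u₁ u₂ (w n) ≤ C)
    (hlim : ∀ x, Tendsto (fun n => w n x) atTop (𝓝 (v x))) :
    ZeroSob p d Ω v ∧ u₁ ≤ v ∧ v ≤ u₂ ∧ functional p d Ω g u₁ u₂ v ≤ C := by
  have hp := B.p_pos
  have hv₁ : u₁ ≤ v := fun x => ge_of_tendsto' (hlim x) fun n => h₁ n x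
  have hv₂ : v ≤ u₂ := fun x => le_of_tendsto' (hlim x) fun n => h₂ n x
  have hvm : Measurable v := measurable_of_tendsto_metrizable (fun n => (hw n).meas)
    (tendsto_pi_nhds.2 hlim)
  have hv0 : ∀ x ∉ Ω, v x = 0 := fun x hx =>
    tendsto_nhds_unique (hlim x) (by simp [(hw _).zero x hx])
  have hG : Tendsto (fun n => ∫ x in Ω, primitive g u₁ u₂ x (w n x)) atTop
      (𝓝 (∫ x in Ω, primitive g u₁ u₂ x (v x))) := by
    refine tendsto_integral_of_dominated_convergence _
      (fun n => (B.measurable_primitive (hw n).meas).aestronglyMeasurable)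
      B.integrableOn_bound_mul_barriers
      (fun n => Eventually.of_forall fun x => B.abs_primitive_le_of_mem (h₁ n x) (h₂ n x))
      (Eventually.of_forall fun x => ?_)
    exact ((B.hasDerivAt_primitive x (v x)).continuousAt.tendsto).comp (hlim x)
  set D := p * (C + ∫ x in Ω, primitive g u₁ u₂ x (v x)) with hD
  have hElim : Tendsto (fun n => ENNReal.ofReal (p * (C + ∫ x in Ω, primitive g u₁ u₂ x (w n x))))
      atTop (𝓝 (ENNReal.ofReal D)) :=
    (ENNReal.continuous_ofReal.tendsto _).comp ((hG.const_add C).const_mul p)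
  have hfatou : ∫⁻ z, ENNReal.ofReal (|incr v z| ^ p) ∂(kernelMeasure N d) ≤
      ENNReal.ofReal D := by
    calc ∫⁻ z, ENNReal.ofReal (|incr v z| ^ p) ∂(kernelMeasure N d)
        = ∫⁻ z, liminf (fun n => ENNReal.ofReal (|incr (w n) z| ^ p)) atTop
            ∂(kernelMeasure N d) := by
          refine lintegral_congr fun z => (Tendsto.liminf_eq ?_).symm
          have : Tendsto (fun n => incr (w n) z) atTop (𝓝 (incr v z)) :=
            (hlim z.1).sub (hlim z.2)
          exact (ENNReal.continuous_ofReal.tendsto _).comp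
            (this.abs.rpow_const (Or.inr hp.le))
      _ ≤ liminf (fun n => ∫⁻ z, ENNReal.ofReal (|incr (w n) z| ^ p) ∂(kernelMeasure N d))
            atTop := by
          refine lintegral_liminf_le fun n => ?_
          have := measurable_incr (hw n).meas
          fun_prop
      _ ≤ liminf (fun n => ENNReal.ofReal
            (p * (C + ∫ x in Ω, primitive g u₁ u₂ x (w n x)))) atTop := by
          refine liminf_le_liminf (Eventually.of_forall fun n => ?_)
          rw [← ofReal_integral_eq_lintegral_ofReal (hw n).energy
            (Eventually.of_forall fun z => by positivity)]
          refine ENNReal.ofReal_le_ofReal ?_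
          have h := hC n
          rw [functional, sub_le_iff_le_add, div_le_iff₀ hp] at h
          rw [mul_comm]
          exact h
      _ = ENNReal.ofReal D := hElim.liminf_eq
  have hvE : Integrable (fun z => |incr v z| ^ p) (kernelMeasure N d) := by
    refine ⟨Measurable.aestronglyMeasurable (by fun_prop), ?_⟩
    rw [hasFiniteIntegral_iff_ofReal (Eventually.of_forall fun z => by positivity)]
    exact hfatou.trans_lt ENNReal.ofReal_lt_top
  have hΩU : Ω ⊆ U := fun x hx => by
    by_contra h
    have h1 := B.dist_le x hx x h
    have h2 := B.δ_pos
    simp at h1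
    linarith
  have hvL : Integrable fun x => |v x| ^ p := by
    have hmaj : IntegrableOn (fun x => 2 ^ p * (|u₁ x| ^ p + |u₂ x| ^ p)) Ω :=
      ((B.tail₁.lp.mono_set hΩU).add (B.tail₂.lp.mono_set hΩU)).const_mul _
    refine ((integrable_indicator_iff B.measΩ).2 hmaj).mono'
      (Measurable.aestronglyMeasurable (by fun_prop)) (Eventually.of_forall fun x => ?_)
    rw [Real.norm_of_nonneg (by positivity)]
    by_cases hx : x ∈ Ω
    · rw [indicator_of_mem hx]
      have h3 := abs_add_rpow_le hp.le |u₁ x| |u₂ x|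
      rw [abs_of_nonneg (by positivity : 0 ≤ |u₁ x| + |u₂ x|), abs_abs, abs_abs] at h3
      exact (Real.rpow_le_rpow (abs_nonneg _) (abs_le_of_mem (hv₁ x) (hv₂ x)) hp.le).trans h3
    · rw [indicator_of_notMem hx, hv0 x hx, abs_zero, Real.zero_rpow hp.ne']
  have hvZ : ZeroSob p d Ω v := ⟨hvm, hv0, hvL, hvE⟩
  refine ⟨hvZ, hv₁, hv₂, ?_⟩
  have hD0 : 0 ≤ D := by
    refine ge_of_tendsto' ((hG.const_add C).const_mul p) fun n => ?_
    have h := hC n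
    rw [functional, sub_le_iff_le_add, div_le_iff₀ hp] at h
    rw [mul_comm]
    exact (energy_nonneg p d (w n)).trans h
  rw [← ofReal_integral_eq_lintegral_ofReal hvE (Eventually.of_forall fun z => by positivity),
    ENNReal.ofReal_le_ofReal_iff hD0] at hfatou
  rw [functional, sub_le_iff_le_add, div_le_iff₀ hp, mul_comm]
  exact hfatou

/-- The functional attains its minimum over `W₀^{s,p}(Ω)` at a point of the order interval. -/
theorem exists_minimizer (B : Barriers p q d c R δ Ω U g u₁ u₂) :
    ∃ u, ZeroSob p d Ω u ∧ u₁ ≤ u ∧ u ≤ u₂ ∧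
      ∀ w, ZeroSob p d Ω w → functional p d Ω g u₁ u₂ u ≤ functional p d Ω g u₁ u₂ w := by
  have hp := B.p_pos
  set 𝒦 : Set (Sp N → ℝ) := {w | ZeroSob p d Ω w ∧ u₁ ≤ w ∧ w ≤ u₂} with h𝒦
  have hclamp : ∀ w, ZeroSob p d Ω w → (w ⊓ u₂) ⊔ u₁ ∈ 𝒦 := fun w hw =>
    ⟨B.zeroSob_sup (B.zeroSob_inf hw), le_sup_right, sup_le inf_le_right B.le⟩
  suffices hex : ∃ u ∈ 𝒦, ∀ w ∈ 𝒦, functional p d Ω g u₁ u₂ u ≤ functional p d Ω g u₁ u₂ w by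
    obtain ⟨u, hu, hmin⟩ := hex
    exact ⟨u, hu.1, hu.2.1, hu.2.2, fun w hw => (hmin _ (hclamp w hw)).trans
      ((B.functional_sup_le (B.zeroSob_inf hw)).trans (B.functional_inf_le hw))⟩
  refine exists_forall_le_of_submodular 𝒦 (functional p d Ω g u₁ u₂)
    ⟨_, hclamp _ (zeroSob_zero hp)⟩ u₁ u₂ (fun w hw => hw.2)
    (fun v hv w hw => ⟨hv.1.sup hp hw.1, hv.2.1.trans le_sup_left, sup_le hv.2.2 hw.2.2⟩)
    (fun v hv w hw => ⟨hv.1.inf hp hw.1, le_inf hv.2.1 hw.2.1, inf_le_left.trans hv.2.2⟩)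
    (fun v hv w hw => ?_) ⟨-∫ x in Ω,
      c * (1 + (|u₁ x| + |u₂ x|) ^ (q - 1)) * (|u₁ x| + |u₂ x|), fun w hw => ?_⟩
    (fun w v C hw hC hlim => ?_)
  · have h1 := energy_sup_add_energy_inf_le B.two_le hv.1 hw.1
    have h2 : (∫ x in Ω, primitive g u₁ u₂ x ((v ⊔ w) x)) +
        ∫ x in Ω, primitive g u₁ u₂ x ((v ⊓ w) x) =
        (∫ x in Ω, primitive g u₁ u₂ x (v x)) + ∫ x in Ω, primitive g u₁ u₂ x (w x) := by
      rw [← integral_add (B.integrableOn_primitive_of_zeroSob (hv.1.sup hp hw.1))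
        (B.integrableOn_primitive_of_zeroSob (hv.1.inf hp hw.1)),
        ← integral_add (B.integrableOn_primitive_of_zeroSob hv.1)
        (B.integrableOn_primitive_of_zeroSob hw.1)]
      congr 1
      ext x
      simp only [Pi.sup_apply, Pi.inf_apply]
      rcases le_total (v x) (w x) with h | h
      · rw [sup_of_le_right h, inf_of_le_left h, add_comm]
      · rw [sup_of_le_left h, inf_of_le_right h]
    have h3 := div_le_div_of_nonneg_right h1 hp.le
    rw [add_div, add_div] at h3
    simp only [functional]
    linarith
  · have h1 : ∫ x in Ω, primitive g u₁ u₂ x (w x) ≤ ∫ x in Ω,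
        c * (1 + (|u₁ x| + |u₂ x|) ^ (q - 1)) * (|u₁ x| + |u₂ x|) :=
      integral_mono (B.integrableOn_primitive_of_zeroSob hw.1) B.integrableOn_bound_mul_barriers
        fun x => (le_abs_self _).trans (B.abs_primitive_le_of_mem (hw.2.1 x) (hw.2.2 x))
    have h2 := div_nonneg (energy_nonneg p d w) hp.le
    simp only [functional]
    linarith
  · obtain ⟨h1, h2, h3, h4⟩ := B.functional_le_of_tendsto (fun n => (hw n).1)
      (fun n => (hw n).2.1) (fun n => (hw n).2.2) hC hlim
    exact ⟨⟨h1, h2, h3⟩, h4⟩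

/-! ### The Euler-Lagrange equation -/

/-- One half of the Euler-Lagrange equation; the other half is this inequality for `-v`. -/
lemma integral_truncated_mul_le (B : Barriers p q d c R δ Ω U g u₁ u₂) {u v : Sp N → ℝ}
    (hu : ZeroSob p d Ω u) (hv : ZeroSob p d Ω v)
    (hmin : ∀ w, ZeroSob p d Ω w → functional p d Ω g u₁ u₂ u ≤ functional p d Ω g u₁ u₂ w) :
    ∫ x in Ω, truncated g u₁ u₂ x (u x) * v x ≤
      ∫ z, oddPow p (incr u z) * incr v z ∂(kernelMeasure N d) := by
  have hp := B.p_pos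
  set t : ℕ → ℝ := fun n => 1 / ((n : ℝ) + 1) with ht
  have ht0 : ∀ n, 0 < t n := fun n => by positivity
  have ht1 : ∀ n, t n ≤ 1 := fun n => by
    rw [ht]
    exact div_le_one_of_le₀ (by linarith [(Nat.cast_nonneg n : (0 : ℝ) ≤ n)]) (by positivity)
  have htlim : Tendsto t atTop (𝓝 0) := tendsto_one_div_add_atTop_nhds_zero_nat
  set m : ℕ → Sp N → ℝ := fun n x => u x + t n * v x with hm
  have hmZ : ∀ n, ZeroSob p d Ω (m n) := fun n => hu.add hp (hv.const_mul (t n))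
  have hmincr : ∀ n z, incr (m n) z = incr u z + t n * incr v z := fun n z => by
    simp only [hm, incr]; ring
  -- Convexity of the energy bounds its difference quotient by the pairing at the perturbed point.
  have hquot : ∀ n, ∫ x in Ω, (t n)⁻¹ * (primitive g u₁ u₂ x (m n x) -
      primitive g u₁ u₂ x (u x)) ≤
        ∫ z, oddPow p (incr u z + t n * incr v z) * incr v z ∂(kernelMeasure N d) := by
    intro n
    have h1 := energy_add_le B.two_le (hmZ n) hu
    have e : ∀ z, oddPow p (incr (m n) z) * (incr u z - incr (m n) z) =
        (-t n) * (oddPow p (incr u z + t n * incr v z) * incr v z) := fun z => by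
      rw [hmincr]; ring
    simp only [e, integral_const_mul] at h1
    have h2 := hmin _ (hmZ n)
    simp only [functional] at h2
    rw [integral_const_mul, integral_sub (B.integrableOn_primitive_of_zeroSob (hmZ n))
      (B.integrableOn_primitive_of_zeroSob hu), inv_mul_le_iff₀ (ht0 n)]
    have h3 : energy p d (m n) / p ≤ energy p d u / p + t n *
        ∫ z, oddPow p (incr u z + t n * incr v z) * incr v z ∂(kernelMeasure N d) := by
      rw [div_add' _ _ _ hp.ne', div_le_div_iff_of_pos_right hp]
      linarith
    linarith
  have hleft : Tendsto (fun n => ∫ x in Ω, (t n)⁻¹ * (primitive g u₁ u₂ x (m n x) -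
      primitive g u₁ u₂ x (u x))) atTop (𝓝 (∫ x in Ω, truncated g u₁ u₂ x (u x) * v x)) := by
    refine tendsto_integral_of_dominated_convergence
      (fun x => c * (1 + (|u₁ x| + |u₂ x|) ^ (q - 1)) * |v x|)
      (fun n => (((B.measurable_primitive (hmZ n).meas).sub
        (B.measurable_primitive hu.meas)).const_mul _).aestronglyMeasurable)
      (B.integrableOn_bound_mul hv.meas (B.embed v hv).integrableOn)
      (fun n => Eventually.of_forall fun x => ?_) (Eventually.of_forall fun x => ?_)
    · have h1 := B.abs_primitive_sub_le x (u x) (m n x)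
      have h2 : m n x - u x = t n * v x := by simp only [hm]; ring
      rw [h2, abs_mul, abs_of_pos (ht0 n)] at h1
      rw [norm_mul, Real.norm_eq_abs, Real.norm_eq_abs, abs_of_pos (inv_pos.2 (ht0 n)),
        inv_mul_le_iff₀ (ht0 n)]
      linarith
    · have h1 : HasDerivAt (fun r : ℝ => u x + r * v x) (v x) 0 := by
        simpa using ((hasDerivAt_id (0 : ℝ)).mul_const (v x)).const_add (u x)
      have h2 : HasDerivAt (fun r : ℝ => primitive g u₁ u₂ x (u x + r * v x))
          (truncated g u₁ u₂ x (u x) * v x) 0 := by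
        have := B.hasDerivAt_primitive x (u x + 0 * v x)
        have h3 := HasDerivAt.comp (0 : ℝ) this h1
        rwa [zero_mul, add_zero] at h3
      have h4 := (hasDerivAt_iff_tendsto_slope_zero.1 h2).comp
        (tendsto_nhdsWithin_iff.2 ⟨htlim, Eventually.of_forall fun n => (ht0 n).ne'⟩)
      simpa [Function.comp_def] using h4
  have hright : Tendsto (fun n => ∫ z, oddPow p (incr u z + t n * incr v z) * incr v z
      ∂(kernelMeasure N d)) atTop
      (𝓝 (∫ z, oddPow p (incr u z) * incr v z ∂(kernelMeasure N d))) := by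
    have hmu := measurable_incr hu.meas
    have hmv := measurable_incr hv.meas
    refine tendsto_integral_of_dominated_convergence
      (fun z => 2 ^ p * (|incr u z| ^ p + |incr v z| ^ p) + |incr v z| ^ p)
      (fun n => (((continuous_oddPow B.two_le).measurable.comp (hmu.add
        (hmv.const_mul _))).mul hmv).aestronglyMeasurable)
      (((hu.energy.add hv.energy).const_mul _).add hv.energy)
      (fun n => Eventually.of_forall fun z => ?_) (Eventually.of_forall fun z => ?_)
    · refine (abs_oddPow_mul_le B.two_le _ _).trans ?_
      have h1 := abs_add_rpow_le hp.le (incr u z) (t n * incr v z)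
      have h2 : |t n * incr v z| ^ p ≤ |incr v z| ^ p := by
        refine Real.rpow_le_rpow (abs_nonneg _) ?_ hp.le
        rw [abs_mul, abs_of_pos (ht0 n)]
        exact mul_le_of_le_one_left (abs_nonneg _) (ht1 n)
      have h3 : (2 : ℝ) ^ p * (|incr u z| ^ p + |t n * incr v z| ^ p) ≤
          2 ^ p * (|incr u z| ^ p + |incr v z| ^ p) :=
        mul_le_mul_of_nonneg_left (by linarith) (by positivity)
      linarith
    · have h1 : Tendsto (fun n => incr u z + t n * incr v z) atTop (𝓝 (incr u z)) := by
        simpa using (htlim.mul_const (incr v z)).const_add (incr u z)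
      exact (((continuous_oddPow B.two_le).tendsto _).comp h1).mul_const _
  exact le_of_tendsto_of_tendsto' hleft hright hquot

/-- Between ordered barriers there is a weak solution. -/
theorem exists_solution (B : Barriers p q d c R δ Ω U g u₁ u₂) :
    ∃ u, ZeroSob p d Ω u ∧ u₁ ≤ u ∧ u ≤ u₂ ∧ ∀ v, ZeroSob p d Ω v →
      ∫ z, oddPow p (incr u z) * incr v z ∂(kernelMeasure N d) = ∫ x in Ω, g x (u x) * v x := by
  obtain ⟨u, hu, h₁, h₂, hmin⟩ := B.exists_minimizer
  refine ⟨u, hu, h₁, h₂, fun v hv => ?_⟩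
  have e : ∀ x, truncated g u₁ u₂ x (u x) = g x (u x) := fun x => truncated_of_mem x (h₁ x) (h₂ x)
  have h1 := B.integral_truncated_mul_le hu hv hmin
  have h2 := B.integral_truncated_mul_le hu (hv.const_mul (-1)) hmin
  have e2 : ∀ z, incr (fun x => -v x) z = -incr v z := fun z => by simp only [incr]; ring
  simp only [e, neg_one_mul, e2, mul_neg, integral_neg] at h1 h2
  linarith

end Barriers

/-! ### Passage to measurable representatives -/

lemma MemWt.aemeasurable {s p : ℝ} {Ω : Set (Sp N)} {u : Sp N → ℝ} (hu : MemWt s p Ω u) :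
    AEMeasurable u := by
  have h : AEMeasurable u (volume.restrict (⋃ n : ℕ, Metric.closedBall (0 : Sp N) n)) :=
    aemeasurable_iUnion_iff.2 fun n =>
      (hu.1 _ (isCompact_closedBall 0 (n : ℝ))).1.aemeasurable
  rwa [Metric.iUnion_closedBall_nat, Measure.restrict_univ] at h

/-- A measurable representative of an element of `W̃^{s,p}(Ω)`. -/
lemma MemWt.exists_tailSob {s p : ℝ} (hp : 0 < p) {Ω : Set (Sp N)} {u u' : Sp N → ℝ}
    (hu : MemWt s p Ω u) (hu' : Measurable u') (huu' : u =ᵐ[volume] u') :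
    ∃ U : Set (Sp N), IsOpen U ∧ closure Ω ⊆ U ∧ TailSob p ((N : ℝ) + p * s) U u' := by
  obtain ⟨-, ⟨U, hUo, hΩU, hUW⟩, htail⟩ := hu
  have hW := (memW_iff hp hUo.measurableSet hu').1 (memW_congr huu' hUW)
  refine ⟨U, hUo, hΩU, hu', hW.1, hW.2, Measurable.aestronglyMeasurable (by fun_prop), ?_⟩
  rw [hasFiniteIntegral_iff_ofReal (Eventually.of_forall fun x => by positivity)]
  refine lt_of_eq_of_lt (lintegral_congr_ae ?_) htail
  filter_upwards [huu'] with x hx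
  rw [hx, Real.rpow_neg (by positivity), div_eq_mul_inv]

lemma ZeroSob.memW₀ {s p : ℝ} (hp : 0 < p) {Ω : Set (Sp N)} {v : Sp N → ℝ}
    (hv : ZeroSob p ((N : ℝ) + p * s) Ω v) : MemW₀ s p Ω v :=
  ⟨(memW_iff hp MeasurableSet.univ hv.meas).2 ⟨hv.lp.integrableOn, hv.energy.integrableOn⟩,
    Eventually.of_forall hv.zero⟩

lemma MemW₀.exists_zeroSob {s p : ℝ} (hp : 0 < p) {Ω : Set (Sp N)} (hΩ : MeasurableSet Ω)
    {v : Sp N → ℝ} (hv : MemW₀ s p Ω v) :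
    ∃ v', ZeroSob p ((N : ℝ) + p * s) Ω v' ∧ v =ᵐ[volume] v' := by
  have hm : AEMeasurable v := by
    have := hv.1.1.1.aemeasurable
    rwa [Measure.restrict_univ] at this
  have hm' : Measurable (Ω.indicator (hm.mk v)) := hm.measurable_mk.indicator hΩ
  have e : v =ᵐ[volume] Ω.indicator (hm.mk v) := by
    filter_upwards [hm.ae_eq_mk, hv.2] with x h1 h2
    by_cases hx : x ∈ Ω
    · rw [indicator_of_mem hx, h1]
    · rw [indicator_of_notMem hx, h2 hx]
  have h := (memW_iff hp MeasurableSet.univ hm').1 (memW_congr e hv.1)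
  rw [univ_prod_univ, integrableOn_univ, integrableOn_univ] at h
  exact ⟨_, ⟨hm', fun x hx => indicator_of_notMem hx _, h.1, h.2⟩, e⟩

/-- A bounded set is at positive distance from the complement of any neighbourhood of its
closure. -/
lemma exists_pos_le_norm_sub {Ω U : Set (Sp N)} (hΩ : Bornology.IsBounded Ω) (hU : IsOpen U)
    (hΩU : closure Ω ⊆ U) : ∃ δ : ℝ, 0 < δ ∧ ∀ x ∈ Ω, ∀ y ∉ U, δ ≤ ‖x - y‖ := by
  obtain ⟨δ, hδ, hsub⟩ := hΩ.isCompact_closure.exists_cthickening_subset_open hU hΩU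
  refine ⟨δ, hδ, fun x hx y hy => ?_⟩
  by_contra! h
  refine hy (hsub (Metric.mem_cthickening_of_dist_le y x δ _ (subset_closure hx) ?_))
  rw [dist_comm, dist_eq_norm]
  exact h.le

end FracPLap

open FracPLap in
theorem lemma3p2 (N : ℕ) (hN : 1 < N) (s p : ℝ) (hs₀ : 0 < s) (hs₁ : s < 1) (hp : 2 ≤ p)
    (hps : p * s < (N : ℝ)) (Ω : Set (FracPLap.Sp N)) (hΩ : FracPLap.IsC11Domain Ω)
    (f : FracPLap.Sp N → ℝ → ℝ) (hf : FracPLap.H₀ s p Ω f)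
    (u₁ u₂ : FracPLap.Sp N → ℝ) (hu : FracPLap.IsSubSuperPair s p Ω f u₁ u₂) :
    ∃ u : FracPLap.Sp N → ℝ, u ∈ FracPLap.solutionSet s p Ω f u₁ u₂ := by
  classical
  obtain ⟨hsub, hsup, hle⟩ := hu
  obtain ⟨hcar, c, q, hc, hpq, hq, hgrow⟩ := hf
  have hp0 : 0 < p := by linarith
  have hN0 : 0 < N := by omega
  have hNpos : (0 : ℝ) < N := by positivity
  have hps0 : 0 < p * s := by positivity
  have hΩm : MeasurableSet Ω := hΩ.isOpen.measurableSet
  obtain ⟨g, hgm, hgc, hgg, hgf⟩ := exists_measurable_caratheodory hc.le hcar hgrow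
  have hm₁ := hsub.1.aemeasurable
  have hm₂ := hsup.1.aemeasurable
  -- Representatives for which the order relations hold at every point.
  set w₁ : Sp N → ℝ := Ω.piecewise (hm₁.mk u₁) (fun x => hm₁.mk u₁ x ⊓ 0) with hw₁
  set w₂ : Sp N → ℝ :=
    Ω.piecewise (fun x => hm₁.mk u₁ x ⊔ hm₂.mk u₂ x) (fun x => hm₂.mk u₂ x ⊔ 0) with hw₂
  have hw₁m : Measurable w₁ :=
    hm₁.measurable_mk.piecewise hΩm (hm₁.measurable_mk.inf measurable_const)
  have hw₂m : Measurable w₂ := (hm₁.measurable_mk.sup hm₂.measurable_mk).piecewise hΩm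
    (hm₂.measurable_mk.sup measurable_const)
  have e₁ : u₁ =ᵐ[volume] w₁ := by
    filter_upwards [hm₁.ae_eq_mk, hsub.2.1] with x h1 h2
    by_cases hx : x ∈ Ω
    · simp [hw₁, hx, ← h1]
    · simp [hw₁, hx, ← h1, h2 hx]
  have e₂ : u₂ =ᵐ[volume] w₂ := by
    filter_upwards [hm₁.ae_eq_mk, hm₂.ae_eq_mk, hsup.2.1, hle] with x h0 h1 h2 h3
    by_cases hx : x ∈ Ω
    · simp [hw₂, hx, ← h0, ← h1, h3 hx]
    · simp [hw₂, hx, ← h1, h2 hx]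
  have hw₁0 : ∀ x ∉ Ω, w₁ x ≤ 0 := fun x hx => by simp [hw₁, hx]
  have hw₂0 : ∀ x ∉ Ω, 0 ≤ w₂ x := fun x hx => by simp [hw₂, hx]
  have hw₁₂ : ∀ x, w₁ x ≤ w₂ x := fun x => by
    by_cases hx : x ∈ Ω
    · simp [hw₁, hw₂, hx]
    · exact (hw₁0 x hx).trans (hw₂0 x hx)
  obtain ⟨U₁, hU₁o, hΩU₁, ht₁⟩ := hsub.1.exists_tailSob hp0 hw₁m e₁
  obtain ⟨U₂, hU₂o, hΩU₂, ht₂⟩ := hsup.1.exists_tailSob hp0 hw₂m e₂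
  obtain ⟨δ, hδ, hdist⟩ := exists_pos_le_norm_sub hΩ.isBounded (hU₁o.inter hU₂o)
    (subset_inter hΩU₁ hΩU₂)
  obtain ⟨R, hR⟩ := hΩ.isBounded.exists_norm_le
  replace ht₁ := ht₁.mono (inter_subset_left : U₁ ∩ U₂ ⊆ U₁)
  replace ht₂ := ht₂.mono (inter_subset_right : U₁ ∩ U₂ ⊆ U₂)
  have hUm : MeasurableSet (U₁ ∩ U₂) := (hU₁o.inter hU₂o).measurableSet
  have hd : (N : ℝ) < N + p * s := by linarith
  have hdp : (N : ℝ) + p * s < N + p := by nlinarith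
  have hd2 : (N : ℝ) + p * s < 2 * N := by linarith
  have hcrit : q < p / (2 - ((N : ℝ) + p * s) / N) := by
    have h1 : 2 - ((N : ℝ) + p * s) / N = (N - p * s) / N := by field_simp; ring
    rwa [h1, div_div_eq_mul_div, mul_comm p]
  have hgfw : ∀ {u w v v' : Sp N → ℝ}, u =ᵐ[volume] w → v =ᵐ[volume] v' →
      ∫ x in Ω, f x (u x) * v x = ∫ x in Ω, g x (w x) * v' x := fun {u w v v'} h h' => by
    refine integral_congr_ae ?_
    filter_upwards [hgf, ae_restrict_of_ae h, ae_restrict_of_ae h'] with x h1 h2 h3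
    rw [h1, h2, h3]
  have B : Barriers p q ((N : ℝ) + p * s) c R δ Ω (U₁ ∩ U₂) g w₁ w₂ :=
    { two_le := hp
      le_q := hpq.le
      lt_d := hd
      c_nonneg := hc.le
      δ_pos := hδ
      measΩ := hΩm
      measU := hUm
      norm_le := hR
      dist_le := hdist
      meas_g := hgm
      cont_g := hgc
      growth := hgg
      tail₁ := ht₁
      tail₂ := ht₂
      le := hw₁₂
      nonpos₁ := hw₁0
      nonneg₂ := hw₂0
      embed := fun v hv => integrable_abs_rpow_of_lt_critical hN0 hp0 hd hd2 hpq.le hcrit hv.meas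
        hv.lp hv.energy
      lq₁ := ht₁.integrableOn_abs_rpow hN0 hp0 hd hdp hd2 hpq.le hcrit hδ hUm
        hΩ.isConnected.nonempty hΩm hR hdist
      lq₂ := ht₂.integrableOn_abs_rpow hN0 hp0 hd hdp hd2 hpq.le hcrit hδ hUm
        hΩ.isConnected.nonempty hΩm hR hdist
      sub := fun v hv hv0 => by
        rw [← pairing_eq_integral, ← pairing_congr e₁ (ae_eq_refl v),
          ← hgfw e₁ (ae_eq_refl v)]
        exact hsub.2.2 v (hv.memW₀ hp0) (Filter.Eventually.of_forall hv0)
      super := fun v hv hv0 => by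
        rw [← pairing_eq_integral, ← pairing_congr e₂ (ae_eq_refl v),
          ← hgfw e₂ (ae_eq_refl v)]
        exact hsup.2.2 v (hv.memW₀ hp0) (Filter.Eventually.of_forall hv0) }
  obtain ⟨u, hu, h₁, h₂, hsol⟩ := B.exists_solution
  refine ⟨u, ⟨hu.memW₀ hp0, fun v hv => ?_⟩, ?_⟩
  · obtain ⟨v', hv', e⟩ := hv.exists_zeroSob hp0 hΩm
    rw [pairing_congr (ae_eq_refl u) e, pairing_eq_integral, hsol v' hv',
      hgfw (ae_eq_refl u) e]
  · filter_upwards [e₁, e₂] with x hx₁ hx₂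
    rw [hx₁, hx₂]
    exact ⟨h₁ x, h₂ x⟩
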